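/- Let $X,Y,Z,U$ denote four jointly distributed random variables with finitely many states. Their entropy vector $h$ assigns to each $I\subseteq\{X,Y,Z,U\}$ the Shannon entropy $h(I)$ of the random vector formed by the variables in $I$ (so $h(\emptyset)=0$). An elementary conditional independence (CI) statement $(i,j|K)$ consists of an unordered pair of distinct variables $i,j$ and a subset $K\subseteq\{X,Y,Z,U\}\setminus\{i,j\}$; put $$\Delta(i,j|K)\cdot h = h(\{i\}\cup K)+h(\{j\}\cup K)-h(\{i,j\}\cup K)-h(K),$$ the conditional mutual information; the statement $(i,j|K)$ holds for $h$ if $\Delta(i,j|K)\cdot h=0$. We write $(i,j)$ for $(i,j|\emptyset)$. The Ingleton expression is $$\square\cdot h = h(XZ)+h(XU)+h(YZ)+h(YU)+h(ZU)-h(XY)-h(Z)-h(U)-h(XZU)-h(YZU).$$ A set $\mathcal L$ of elementary CI statements *implies the Ingleton inequality* if $\square\cdot h\ge 0$ for every entropy vector $h$ for which all statements of $\mathcal L$ hold. Such a conditional inequality is *essentially conditional* if there are no real multipliers $\lambda_c\ge 0$ ($c\in\mathcal L$) such that $\square\cdot h+\sum_{c\in\mathcal L}\lambda_c\,\Delta(c)\cdot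 h\ge 0$ for all entropy vectors $h$. **Theorem.** Up to the symmetries generated by $X\leftrightarrow Y$ and $Z\leftrightarrow U$, there are precisely ten inclusion-minimal sets of elementary CI statements that imply the Ingleton inequality, namely the following ten, which are pairwise inequivalent under these symmetries: - (1.1) $\{(Z,U)\}$; (1.2) $\{(X,Z)\}$; (1.3) $\{(X,Z|Y)\}$; (1.4) $\{(X,Y|ZU)\}$; (1.5) $\{(X,Z|YU)\}$; - (2.1) $\{(X,Y),\,(X,Y|Z)\}$; (2.2) $\{(X,Y|Z),\,(Y,U|Z)\}$; (2.3) $\{(X,Z|U),\,(X,U|Z)\}$; (2.4) $\{(X,Z|U),\,(Z,U|X)\}$; (2.5) $\{(X,Z|U),\,(Y,Z|U)\}$. The conditional Ingleton inequalities given by (1.1)–(1.5) are not essentially conditional, and those given by (2.1)–(2.5) are essentially conditional. Moreover, for (2.5) this is witnessed by the following curve of binary distributions, where $p_{ijkl}=P(X=i,Y=j,Z=k,U=l)$: $$p_{0010}=\tfrac15-\varepsilon,\quad p_{0110}=p_{1010}=p_{1101}=p_{1111}=\tfrac15,\quad p_{1100}=\varepsilon,$$ all other probabilities being $0$: for all multipliers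 $\lambda_1,\lambda_2\ge 0$ there is $\varepsilon_0>0$ such that for all $0<\varepsilon<\varepsilon_0$ the entropy vector $h$ of this distribution satisfies $$\square\cdot h+\lambda_1\,\Delta(X,Z|U)\cdot h+\lambda_2\,\Delta(Y,Z|U)\cdot h<0 .$$ -/

import Mathlib

open MeasureTheory

noncomputable section

namespace CondIngleton

/-- The labels of the four random variables. -/
inductive Var
  | X | Y | Z | U
  deriving DecidableEq

instance : Fintype Var :=
  ⟨{Var.X, Var.Y, Var.Z, Var.U}, by intro v; cases v <;> decide⟩

/-! ### Entropy vectors -/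

/-- Shannon entropy (natural logarithm) of a random variable `W` with finitely many states:
`∑ s, P(W = s) log (1 / P(W = s))`, with the convention `0 log (1 / 0) = 0`. -/
def entropy {Ω S : Type} [MeasurableSpace Ω] [Fintype S] (μ : Measure Ω) (W : Ω → S) : ℝ :=
  ∑ s : S, Real.negMulLog (μ.real (W ⁻¹' {s}))

/-- The entropy vector of four jointly distributed discrete random variables: it sends a set `I`
of labels to the entropy of the vector-valued random variable `(ξ v : v ∈ I)`. -/
def entropyVector {Ω : Type} [MeasurableSpace Ω] (μ : Measure Ω) {q : Var → ℕ}
    (ξ : (v : Var) → Ω → Fin (q v)) : Finset Var → ℝ :=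
  fun I => entropy μ (fun ω (v : I) => ξ v ω)

/-- Membership in the entropy region: `h` is the entropy vector of four random variables with
finitely many states on a common probability space. -/
def IsEntropic (h : Finset Var → ℝ) : Prop :=
  ∃ (Ω : Type) (_ : MeasurableSpace Ω) (μ : Measure Ω) (_ : IsProbabilityMeasure μ)
    (q : Var → ℕ) (ξ : (v : Var) → Ω → Fin (q v)),
    (∀ v, Measurable (ξ v)) ∧ h = entropyVector μ ξ

/-- `h` is the entropy vector of four binary random variables whose joint distribution is given
by the atomic probabilities `p i j k l = P(X = i, Y = j, Z = k, U = l)`. -/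
def IsBinaryEntropic (p : Fin 2 → Fin 2 → Fin 2 → Fin 2 → ℝ) (h : Finset Var → ℝ) : Prop :=
  ∃ (Ω : Type) (_ : MeasurableSpace Ω) (μ : Measure Ω) (_ : IsProbabilityMeasure μ)
    (ξ : Var → Ω → Fin 2),
    (∀ v, Measurable (ξ v)) ∧
    (∀ i j k l, μ.real {ω | ξ Var.X ω = i ∧ ξ Var.Y ω = j ∧ ξ Var.Z ω = k ∧ ξ Var.U ω = l}
      = p i j k l) ∧
    h = entropyVector (q := fun _ => 2) μ ξ

/-! ### The Ingleton expression -/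

open Var in
/-- The Ingleton expression for `XY|ZU`. -/
def ingleton (h : Finset Var → ℝ) : ℝ :=
  h {X, Z} + h {X, U} + h {Y, Z} + h {Y, U} + h {Z, U}
    - h {X, Y} - h {Z} - h {U} - h {X, Z, U} - h {Y, Z, U}

/-! ### Elementary conditional independence statements -/

/-- An elementary conditional independence statement `(i, j | K)`: an unordered pair `{i, j}` of
distinct labels (first component) and a set `K` containing neither (second component). -/
abbrev ElemCI : Type :=
  {c : Finset Var × Finset Var // c.1.card = 2 ∧ Disjoint c.1 c.2}

/-- The elementary statement `(i, j | K)`. -/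
def ci (i j : Var) (K : Finset Var) (hij : i ≠ j ∧ i ∉ K ∧ j ∉ K := by decide) : ElemCI :=
  ⟨({i, j}, K), Finset.card_pair hij.1, by
    simp [Finset.disjoint_insert_left, hij.2.1, hij.2.2]⟩

/-- The difference expression (conditional mutual information)
`h(iK) + h(jK) - h(ijK) - h(K)` of an elementary statement `(i, j | K)`; see `delta_ci`. -/
def delta (c : ElemCI) (h : Finset Var → ℝ) : ℝ :=
  (∑ v ∈ c.1.1, h ({v} ∪ c.1.2)) - h (c.1.1 ∪ c.1.2) - h c.1.2

theorem delta_ci (i j : Var) (K : Finset Var) (hij : i ≠ j ∧ i ∉ K ∧ j ∉ K)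
    (h : Finset Var → ℝ) :
    delta (ci i j K hij) h = h ({i} ∪ K) + h ({j} ∪ K) - h ({i, j} ∪ K) - h K := by
  simp only [delta, ci, Finset.sum_pair hij.1]

/-- The set `L` of conditional independence assumptions makes the Ingleton inequality hold for
entropy vectors. -/
def ImpliesIngleton (L : Finset ElemCI) : Prop :=
  ∀ h : Finset Var → ℝ, IsEntropic h → (∀ c ∈ L, delta c h = 0) → 0 ≤ ingleton h

/-- The conditional Ingleton inequality with assumptions `L` is essentially conditional: there are
no nonnegative multipliers `lam c`, `c ∈ L`, which make the unconditional inequality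
`ingleton h + ∑ c ∈ L, lam c * delta c h ≥ 0` valid for all entropy vectors `h`. -/
def EssentiallyConditional (L : Finset ElemCI) : Prop :=
  ¬ ∃ lam : ElemCI → ℝ, (∀ c ∈ L, 0 ≤ lam c) ∧
    ∀ h : Finset Var → ℝ, IsEntropic h → 0 ≤ ingleton h + ∑ c ∈ L, lam c * delta c h

/-! ### Symmetries -/

/-- The group generated by the exchanges `X ↔ Y` and `Z ↔ U`. -/
def symmetries : Subgroup (Equiv.Perm Var) :=
  Subgroup.closure {Equiv.swap Var.X Var.Y, Equiv.swap Var.Z Var.U}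

/-- Relabelling the variables in an elementary statement. -/
def relabel (σ : Equiv.Perm Var) (c : ElemCI) : ElemCI :=
  ⟨(c.1.1.map σ.toEmbedding, c.1.2.map σ.toEmbedding), by
    rw [Finset.card_map]; exact c.2.1, by
    rw [Finset.disjoint_map]; exact c.2.2⟩

/-- `L` and `M` are the same set of assumptions up to the symmetries `X ↔ Y` and `Z ↔ U`. -/
def SameUpToSymmetry (L M : Finset ElemCI) : Prop :=
  ∃ σ ∈ symmetries, L.image (relabel σ) = M

/-! ### The ten sets of assumptions -/

open Var in
/-- The five sets consisting of one assumption. -/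
def single : Fin 5 → Finset ElemCI :=
  ![{ci Z U ∅},
    {ci X Z ∅},
    {ci X Z {Y}},
    {ci X Y {Z, U}},
    {ci X Z {Y, U}}]

open Var in
/-- The five sets consisting of two assumptions. -/
def double : Fin 5 → Finset ElemCI :=
  ![{ci X Y ∅, ci X Y {Z}},
    {ci X Y {Z}, ci Y U {Z}},
    {ci X Z {U}, ci X U {Z}},
    {ci X Z {U}, ci Z U {X}},
    {ci X Z {U}, ci Y Z {U}}]

/-- All ten sets of assumptions. -/
def ten : Fin 5 ⊕ Fin 5 → Finset ElemCI :=
  Sum.elim single double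

/-- The curve of binary distributions `p i j k l`, for small `ε > 0`. -/
def epsCurve (ε : ℝ) : Fin 2 → Fin 2 → Fin 2 → Fin 2 → ℝ :=
  ![![![![0, 0], ![1 / 5 - ε, 0]],
      ![![0, 0], ![1 / 5, 0]]],
    ![![![0, 0], ![1 / 5, 0]],
      ![![ε, 1 / 5], ![0, 1 / 5]]]]

end CondIngleton

end

open CondIngleton

/-! Write `I` for conditional mutual information, `p(xz)` for marginal masses, `η` for `negMulLog`.

Each single assumption works by a Shannon argument: adding its `Δ` once to the Ingleton expression
gives a sum of three conditional mutual informations. Hence these five inequalities are not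
essentially conditional.

The pairs need more. For (2.1), (2.2) and (2.5), two mass functions `r` and `q` are built from
marginals of `p`: `r` is a conditional product, and `q` has total mass at most 1. The assumptions
make the relevant marginals of `r` agree with those of `p`, so every logarithm in the relative
entropy of `r` to `q` integrates to an entropy of `p`. This relative entropy equals the Ingleton
expression, and `gibbs` makes it nonnegative. For (2.3) and (2.4), `exists_doubleMarkov` turns the
two assumptions into a common function `W` of two of the variables; conditioning on `W` leaves only
Shannon inequalities.

Completeness is finite combinatorics. Of the 24 elementary statements, 14 are images of the singles.
The images of the doubles are 14 forbidden pairs among the other ten. A set avoiding all of these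
lies in one of twelve maximal sets, each contained in an image of one of the five sets in
`compatible`. For each of the five, an explicit rational distribution satisfies its statements and
violates Ingleton. So every implying set contains an image of one of the ten; these images form an
antichain, which gives minimality and inequivalence.

Essential conditionality comes from curves of binary distributions along which the Ingleton
expression is negative and dominates both `Δ` terms: order `e² log e` against `e²` for (2.1), `e log
e` against `e` for (2.2), (2.4), (2.5), and `s²` against `s³` for (2.3). -/

namespace CondIngleton

/-! ### Marginals and entropies of finite mass functions -/

section FinitePmf

variable {S T R : Type*} [Fintype S] [DecidableEq T] [DecidableEq R]

/-- The mass function of `f` when the states have masses `p`. -/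
def marg (p : S → ℝ) (f : S → T) (t : T) : ℝ := ∑ s with f s = t, p s

/-- The entropy of `f` when the states have masses `p`. -/
noncomputable def ent [Fintype T] (p : S → ℝ) (f : S → T) : ℝ :=
  ∑ t, Real.negMulLog (marg p f t)

theorem marg_nonneg {p : S → ℝ} (hp : ∀ s, 0 ≤ p s) (f : S → T) (t : T) : 0 ≤ marg p f t :=
  Finset.sum_nonneg fun s _ => hp s

theorem le_marg {p : S → ℝ} (hp : ∀ s, 0 ≤ p s) (f : S → T) (s : S) : p s ≤ marg p f (f s) :=
  Finset.single_le_sum (f := p) (fun s _ => hp s) (by simp)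

theorem marg_pos {p : S → ℝ} (hp : ∀ s, 0 ≤ p s) (f : S → T) {s : S} (hs : 0 < p s) :
    0 < marg p f (f s) :=
  hs.trans_le (le_marg hp f s)

theorem sum_marg_mul [Fintype T] (p : S → ℝ) (f : S → T) (g : T → ℝ) :
    ∑ t, marg p f t * g t = ∑ s, p s * g (f s) := by
  rw [← Finset.sum_fiberwise Finset.univ f fun s => p s * g (f s)]
  refine Finset.sum_congr rfl fun t _ => ?_
  rw [marg, Finset.sum_mul]
  refine Finset.sum_congr rfl fun s hs => ?_
  rw [(Finset.mem_filter.1 hs).2]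

theorem sum_marg [Fintype T] (p : S → ℝ) (f : S → T) : ∑ t, marg p f t = ∑ s, p s := by
  simpa using sum_marg_mul p f fun _ => 1

theorem ent_eq [Fintype T] (p : S → ℝ) (f : S → T) :
    ent p f = -∑ s, p s * Real.log (marg p f (f s)) := by
  rw [← sum_marg_mul p f fun t => Real.log (marg p f t), ent, ← Finset.sum_neg_distrib]
  exact Finset.sum_congr rfl fun t _ => by rw [Real.negMulLog]; ring

/-- Entropy depends only on the partition that a variable induces on the support. Every
identification of entropies of reordered, padded or redundant tuples goes through this. -/
theorem ent_congr [Fintype T] [Fintype R] {p : S → ℝ} {f : S → T} {g : S → R}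
    (h : ∀ s s', p s ≠ 0 → p s' ≠ 0 → (f s = f s' ↔ g s = g s')) : ent p f = ent p g := by
  rw [ent_eq, ent_eq]
  congr 1
  refine Finset.sum_congr rfl fun s _ => ?_
  by_cases hs : p s = 0
  · simp [hs]
  · congr 2
    rw [marg, marg, Finset.sum_filter, Finset.sum_filter]
    refine Finset.sum_congr rfl fun s' _ => ?_
    by_cases hs' : p s' = 0
    · simp [hs']
    · simp only [h s' s hs' hs]

theorem marg_comp_injective {φ : T → R} (hφ : φ.Injective) (p : S → ℝ) (f : S → T) (t : T) :
    marg p (fun s => φ (f s)) (φ t) = marg p f t := by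
  simp only [marg, hφ.eq_iff]

theorem ent_comp_injective [Fintype T] [Fintype R] {φ : T → R} (hφ : φ.Injective) (p : S → ℝ)
    (f : S → T) : ent p (fun s => φ (f s)) = ent p f :=
  ent_congr fun _ _ _ _ => hφ.eq_iff

theorem marg_marg [Fintype T] (p : S → ℝ) (f : S → T) (g : T → R) :
    marg (marg p f) g = marg p fun s => g (f s) := by
  ext r
  have := sum_marg_mul p f fun t => if g t = r then 1 else 0
  simpa [marg, Finset.sum_filter] using this

theorem ent_marg [Fintype T] [Fintype R] (p : S → ℝ) (f : S → T) (g : T → R) :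
    ent (marg p f) g = ent p fun s => g (f s) := by
  rw [ent, ent, marg_marg]

theorem marg_comp_eq [Fintype T] {p r : S → ℝ} {f : S → T} (h : ∀ t, marg r f t = marg p f t)
    (g : T → R) : marg r (fun s => g (f s)) = marg p fun s => g (f s) := by
  rw [← marg_marg p f, ← marg_marg r f, funext h]

theorem sum_marg_pair [Fintype T] (p : S → ℝ) (f : S → T) (g : S → R) (b : R) :
    ∑ a, marg p (fun s => (f s, g s)) (a, b) = marg p g b := by
  simp only [marg, Finset.sum_filter, Prod.mk.injEq]
  rw [Finset.sum_comm]
  simp [ite_and]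

theorem sum_marg_mid {Q : Type*} [DecidableEq Q] [Fintype T] (p : S → ℝ) (e : S → Q) (f : S → T)
    (g : S → R) (a : Q) (c : R) :
    ∑ b, marg p (fun s => (e s, f s, g s)) (a, b, c) = marg p (fun s => (e s, g s)) (a, c) := by
  simp only [marg, Finset.sum_filter, Prod.mk.injEq]
  rw [Finset.sum_comm]
  simp [ite_and]

theorem sum_marg_last {Q : Type*} [DecidableEq Q] [Fintype T] (p : S → ℝ) (e : S → Q) (f : S → R)
    (g : S → T) (a : Q) (b : R) :
    ∑ c, marg p (fun s => (e s, f s, g s)) (a, b, c) = marg p (fun s => (e s, f s)) (a, b) := by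
  simp only [marg, Finset.sum_filter, Prod.mk.injEq]
  rw [Finset.sum_comm]
  simp [ite_and]

theorem marg_pair_eq_zero {p : S → ℝ} (hp : ∀ s, 0 ≤ p s) {f : S → T} {g : S → R}
    {a : T} {b : R} (h : marg p g b = 0) : marg p (fun s => (f s, g s)) (a, b) = 0 := by
  refine le_antisymm (h ▸ ?_) (marg_nonneg hp _ _)
  refine Finset.sum_le_sum_of_subset_of_nonneg (fun s => ?_) fun s _ _ => hp s
  simp +contextual

/-- A cross entropy becomes an entropy once the two marginals agree. This evaluates relative
entropies of an auxiliary `r` in terms of `p`. -/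
theorem negMulLog_marg_cross [Fintype T] {p r : S → ℝ} {f : S → T}
    (h : marg r f = marg p f) : ∑ s, r s * Real.log (marg p f (f s)) = -ent p f := by
  rw [ent_eq, neg_neg, ← sum_marg_mul p f fun t => Real.log (marg p f t), ← h, sum_marg_mul]

/-! ### The inequality of Gibbs -/

theorem gibbs_term {a b : ℝ} (ha : 0 ≤ a) (hb : 0 ≤ b) (h : b = 0 → a = 0) :
    0 ≤ a * (Real.log a - Real.log b) + b - a := by
  rcases ha.eq_or_lt with rfl | ha
  · simpa
  · have hb : 0 < b := hb.lt_of_ne fun hb => ha.ne' (h hb.symm)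
    have := Real.log_le_sub_one_of_pos (div_pos hb ha)
    rw [Real.log_div hb.ne' ha.ne'] at this
    have := mul_le_mul_of_nonneg_left this ha.le
    rw [mul_sub, mul_sub, mul_div_cancel₀ _ ha.ne'] at this
    linarith

theorem gibbs_term_eq {a b : ℝ} (ha : 0 ≤ a) (hb : 0 ≤ b) (h : b = 0 → a = 0)
    (h0 : a * (Real.log a - Real.log b) + b - a = 0) : a = b := by
  rcases ha.eq_or_lt with rfl | ha
  · simpa using h0.symm
  · have hb : 0 < b := hb.lt_of_ne fun hb => ha.ne' (h hb.symm)
    by_contra hne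
    have := Real.log_lt_sub_one_of_pos (div_pos hb ha)
      fun h1 => hne ((div_eq_one_iff_eq ha.ne').1 h1).symm
    rw [Real.log_div hb.ne' ha.ne'] at this
    have := mul_lt_mul_of_pos_left this ha
    rw [mul_sub, mul_sub, mul_div_cancel₀ _ ha.ne'] at this
    linarith

theorem gibbs {p q : S → ℝ} (hp : ∀ s, 0 ≤ p s) (hq : ∀ s, 0 ≤ q s)
    (h : ∀ s, q s = 0 → p s = 0) (hle : ∑ s, q s ≤ ∑ s, p s) :
    0 ≤ ∑ s, p s * (Real.log (p s) - Real.log (q s)) := by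
  have := Finset.sum_nonneg fun s (_ : s ∈ Finset.univ) => gibbs_term (hp s) (hq s) (h s)
  rw [Finset.sum_sub_distrib, Finset.sum_add_distrib] at this
  linarith

/-- The log ratio has to be expanded only on the support of `p`, where all marginals involved are
positive; absolute continuity follows from the same hypothesis. -/
theorem gibbs_of_log {p q l : S → ℝ} (hp : ∀ s, 0 ≤ p s) (hq : ∀ s, 0 ≤ q s)
    (hle : ∑ s, q s ≤ ∑ s, p s)
    (h : ∀ s, 0 < p s → 0 < q s ∧ Real.log (p s) - Real.log (q s) = l s) :
    0 ≤ ∑ s, p s * l s := by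
  have := gibbs hp hq (fun s h0 => by
    by_contra hs
    exact (h s ((hp s).lt_of_ne' hs)).1.ne' h0) hle
  rwa [Finset.sum_congr rfl fun s _ => show p s * _ = p s * l s by
    rcases (hp s).eq_or_lt with h0 | h0
    · simp only [← h0, zero_mul]
    · rw [(h s h0).2]] at this

/-- The relative entropy is at least a sum of the nonnegative terms of `gibbs_term`, so if it
vanishes then each term does, and `gibbs_term_eq` applies pointwise. -/
theorem gibbs_eq {p q : S → ℝ} (hp : ∀ s, 0 ≤ p s) (hq : ∀ s, 0 ≤ q s)
    (h : ∀ s, q s = 0 → p s = 0) (hle : ∑ s, q s ≤ ∑ s, p s)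
    (h0 : ∑ s, p s * (Real.log (p s) - Real.log (q s)) = 0) (s : S) : p s = q s := by
  have hn := fun s (_ : s ∈ Finset.univ) => gibbs_term (hp s) (hq s) (h s)
  have hs := Finset.sum_nonneg hn
  have : ∑ s, (p s * (Real.log (p s) - Real.log (q s)) + q s - p s) = 0 := by
    rw [Finset.sum_sub_distrib, Finset.sum_add_distrib] at hs ⊢
    linarith
  exact gibbs_term_eq (hp s) (hq s) (h s)
    ((Finset.sum_eq_zero_iff_of_nonneg hn).1 this s (Finset.mem_univ s))

end FinitePmf

/-! ### Conditional independence -/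

section CondIndep

variable {S A B C : Type*} [Fintype S] [DecidableEq A] [DecidableEq B] [DecidableEq C]
  {p : S → ℝ} (f : S → A) (g : S → B) (k : S → C)

theorem condProd_eq_zero (hp : ∀ s, 0 ≤ p s) (t : A × B × C)
    (h : marg p (fun s => (f s, k s)) (t.1, t.2.2) *
      marg p (fun s => (g s, k s)) (t.2.1, t.2.2) / marg p k t.2.2 = 0) :
    marg p (fun s => (f s, g s, k s)) t = 0 := by
  by_contra hne
  have : 0 < marg p (fun s => (f s, g s, k s)) t := (marg_nonneg hp _ _).lt_of_ne' hne
  obtain ⟨s, hs, hps⟩ := Finset.exists_ne_zero_of_sum_ne_zero hne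
  obtain rfl := (Finset.mem_filter.1 hs).2
  have hs := (hp s).lt_of_ne' hps
  have h1 := marg_pos hp (fun s => (f s, k s)) hs
  have h2 := marg_pos hp (fun s => (g s, k s)) hs
  have h3 := marg_pos hp k hs
  exact (div_pos (mul_pos h1 h2) h3).ne' h

variable [Fintype A] [Fintype B] [Fintype C]

theorem sum_condProd :
    ∑ a, ∑ b, ∑ c, marg p (fun s => (f s, k s)) (a, c) *
      marg p (fun s => (g s, k s)) (b, c) / marg p k c = ∑ s, p s := by
  rw [← sum_marg p k]
  calc _ = ∑ c, ∑ a, ∑ b, marg p (fun s => (f s, k s)) (a, c) *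
        marg p (fun s => (g s, k s)) (b, c) / marg p k c := by
        rw [Finset.sum_congr rfl fun a _ => Finset.sum_comm, Finset.sum_comm]
    _ = _ := by
        refine Finset.sum_congr rfl fun c _ => ?_
        simp_rw [mul_div_assoc, ← Finset.mul_sum, ← Finset.sum_div, sum_marg_pair]
        -- `x * x / x = x` holds also at `x = 0`, so null cells of `k` need no case split.
        rw [← Finset.sum_mul, sum_marg_pair, ← mul_div_assoc, mul_self_div_self]

/-- The conditional mutual information of `f` and `g` given `k` as a relative entropy. -/
theorem condMutualInfo_eq (hp : ∀ s, 0 ≤ p s) :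
    ∑ t : A × B × C, marg p (fun s => (f s, g s, k s)) t *
      (Real.log (marg p (fun s => (f s, g s, k s)) t) -
        Real.log (marg p (fun s => (f s, k s)) (t.1, t.2.2) *
          marg p (fun s => (g s, k s)) (t.2.1, t.2.2) / marg p k t.2.2)) =
    ent p (fun s => (f s, k s)) + ent p (fun s => (g s, k s)) -
      ent p (fun s => (f s, g s, k s)) - ent p k := by
  rw [sum_marg_mul p (fun s => (f s, g s, k s)) fun t =>
    (Real.log (marg p (fun s => (f s, g s, k s)) t) -
        Real.log (marg p (fun s => (f s, k s)) (t.1, t.2.2) *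
          marg p (fun s => (g s, k s)) (t.2.1, t.2.2) / marg p k t.2.2))]
  simp only [ent_eq, ← Finset.sum_neg_distrib, ← Finset.sum_add_distrib,
    ← Finset.sum_sub_distrib]
  refine Finset.sum_congr rfl fun s _ => ?_
  rcases (hp s).eq_or_lt with h | h
  · simp [← h]
  · have h1 := marg_pos hp (fun s => (f s, k s)) h
    have h2 := marg_pos hp (fun s => (g s, k s)) h
    have h3 := marg_pos hp k h
    rw [Real.log_div (mul_pos h1 h2).ne' h3.ne', Real.log_mul h1.ne' h2.ne']
    ring

theorem sum_condProd_le :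
    ∑ t : A × B × C, marg p (fun s => (f s, k s)) (t.1, t.2.2) *
      marg p (fun s => (g s, k s)) (t.2.1, t.2.2) / marg p k t.2.2 ≤
    ∑ t : A × B × C, marg p (fun s => (f s, g s, k s)) t := by
  rw [sum_marg, ← sum_condProd f g k]
  simp [Fintype.sum_prod_type]

theorem ent_submodular (hp : ∀ s, 0 ≤ p s) :
    ent p (fun s => (f s, g s, k s)) + ent p k ≤
      ent p (fun s => (f s, k s)) + ent p (fun s => (g s, k s)) := by
  have := gibbs (marg_nonneg hp _)
    (fun t => div_nonneg (mul_nonneg (marg_nonneg hp _ _) (marg_nonneg hp _ _))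
      (marg_nonneg hp _ _))
    (condProd_eq_zero f g k hp) (sum_condProd_le f g k)
  rw [condMutualInfo_eq f g k hp] at this
  linarith

/-- The equality case of Gibbs: a vanishing conditional mutual information forces the joint law to
be the conditional product. This is how entropy assumptions become factorizations. -/
theorem condIndep_of_ent_eq (hp : ∀ s, 0 ≤ p s)
    (h : ent p (fun s => (f s, k s)) + ent p (fun s => (g s, k s)) =
      ent p (fun s => (f s, g s, k s)) + ent p k) (a : A) (b : B) (c : C) :
    marg p (fun s => (f s, g s, k s)) (a, b, c) =
      marg p (fun s => (f s, k s)) (a, c) * marg p (fun s => (g s, k s)) (b, c) /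
        marg p k c :=
  gibbs_eq (marg_nonneg hp _)
    (fun t => div_nonneg (mul_nonneg (marg_nonneg hp _ _) (marg_nonneg hp _ _))
      (marg_nonneg hp _ _))
    (condProd_eq_zero f g k hp) (sum_condProd_le f g k)
    (by rw [condMutualInfo_eq f g k hp]; linarith) (a, b, c)

theorem ent_eq_of_condIndep (hp : ∀ s, 0 ≤ p s)
    (h : ∀ s, 0 < p s → marg p (fun s => (f s, g s, k s)) (f s, g s, k s) * marg p k (k s) =
      marg p (fun s => (f s, k s)) (f s, k s) * marg p (fun s => (g s, k s)) (g s, k s)) :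
    ent p (fun s => (f s, k s)) + ent p (fun s => (g s, k s)) =
      ent p (fun s => (f s, g s, k s)) + ent p k := by
  simp only [ent_eq, ← Finset.sum_neg_distrib, ← Finset.sum_add_distrib]
  refine Finset.sum_congr rfl fun s _ => ?_
  rcases (hp s).eq_or_lt with h0 | h0
  · simp [← h0]
  · have h1 := marg_pos hp (fun s => (f s, k s)) h0
    have h2 := marg_pos hp (fun s => (g s, k s)) h0
    have h3 := marg_pos hp k h0
    have h4 := marg_pos hp (fun s => (f s, g s, k s)) h0
    have := congrArg Real.log (h s h0)
    rw [Real.log_mul h4.ne' h3.ne', Real.log_mul h1.ne' h2.ne'] at this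
    linear_combination (p s) * this

theorem ent_le_pair (hp : ∀ s, 0 ≤ p s) :
    ent p k ≤ ent p (fun s => (f s, k s)) := by
  simp only [ent_eq]
  refine neg_le_neg (Finset.sum_le_sum fun s _ => ?_)
  rcases (hp s).eq_or_lt with h | h
  · simp [← h]
  · refine mul_le_mul_of_nonneg_left (Real.log_le_log (marg_pos hp _ h) ?_) h.le
    rw [← sum_marg_pair p f k]
    exact Finset.single_le_sum (f := fun a => marg p (fun s => (f s, k s)) (a, k s))
      (fun a _ => marg_nonneg hp _ _) (Finset.mem_univ _)

end CondIndep
end CondIngleton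

namespace CondIngleton

/-! ### Three-variable marginals of a four-variable mass function -/

section FourVariables

variable {A B C D : Type} [Fintype A] [Fintype B] [Fintype C] [Fintype D]

theorem marg_drop₁ [DecidableEq B] [DecidableEq C] [DecidableEq D] (r : A × B × C × D → ℝ)
    (y : B) (z : C) (u : D) :
    marg r (fun t => (t.2.1, t.2.2.1, t.2.2.2)) (y, z, u) = ∑ x, r (x, y, z, u) := by
  simp [marg, Finset.sum_filter, Fintype.sum_prod_type]

theorem marg_drop₁' [DecidableEq B] [DecidableEq C] [DecidableEq D] (r : A × B × C × D → ℝ)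
    (y : B) (z : C) (u : D) :
    marg r (fun t => (t.2.1, t.2.2.2, t.2.2.1)) (y, u, z) = ∑ x, r (x, y, z, u) := by
  rw [← marg_drop₁]
  exact marg_comp_injective (φ := fun t : B × C × D => (t.1, t.2.2, t.2.1))
    (fun t t' h => by simp only [Prod.mk.injEq] at h; ext <;> tauto) r
    (fun t => (t.2.1, t.2.2.1, t.2.2.2)) (y, z, u)

theorem marg_drop₂ [DecidableEq A] [DecidableEq C] [DecidableEq D] (r : A × B × C × D → ℝ)
    (x : A) (z : C) (u : D) :
    marg r (fun t => (t.1, t.2.2.1, t.2.2.2)) (x, z, u) = ∑ y, r (x, y, z, u) := by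
  simp [marg, Finset.sum_filter, Fintype.sum_prod_type, ite_and]

theorem marg_drop₂' [DecidableEq A] [DecidableEq C] [DecidableEq D] (r : A × B × C × D → ℝ)
    (x : A) (z : C) (u : D) :
    marg r (fun t => (t.1, t.2.2.2, t.2.2.1)) (x, u, z) = ∑ y, r (x, y, z, u) := by
  rw [← marg_drop₂]
  exact marg_comp_injective (φ := fun t : A × C × D => (t.1, t.2.2, t.2.1))
    (fun t t' h => by simp only [Prod.mk.injEq] at h; ext <;> tauto) r
    (fun t => (t.1, t.2.2.1, t.2.2.2)) (x, z, u)

theorem marg_drop₃ [DecidableEq A] [DecidableEq B] [DecidableEq D] (r : A × B × C × D → ℝ)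
    (x : A) (y : B) (u : D) :
    marg r (fun t => (t.1, t.2.1, t.2.2.2)) (x, y, u) = ∑ z, r (x, y, z, u) := by
  simp [marg, Finset.sum_filter, Fintype.sum_prod_type, ite_and]

theorem marg_drop₄ [DecidableEq A] [DecidableEq B] [DecidableEq C] (r : A × B × C × D → ℝ)
    (x : A) (y : B) (z : C) :
    marg r (fun t => (t.1, t.2.1, t.2.2.1)) (x, y, z) = ∑ u, r (x, y, z, u) := by
  simp only [marg, Finset.sum_filter, Fintype.sum_prod_type, Prod.mk.injEq, ite_and]
  rw [Finset.sum_eq_single x (by simp +contextual) (by simp),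
    Finset.sum_eq_single y (by simp +contextual) (by simp),
    Finset.sum_eq_single z (by simp +contextual) (by simp)]
  simp

end FourVariables

/-! ### The double Markov property -/

section DoubleMarkov

variable {S A B C : Type} [Fintype S] [Fintype A] [Fintype B] [Fintype C]
  [DecidableEq A] [DecidableEq B] [DecidableEq C]
  {p : S → ℝ} (f : S → A) (g : S → B) (k : S → C)

/-- The assumptions say that, given `(g, k)`, the law of `f` depends on `k` alone and also on `g`
alone, so the two conditional laws agree on the support. Take `w` to be the conditional law of `f`
given `g` itself: it is a function of `k` almost surely, and it determines the law of `f` given `(g,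
k)`. -/
theorem exists_doubleMarkov (hp : ∀ s, 0 ≤ p s)
    (h₁ : ent p (fun s => (f s, k s)) + ent p (fun s => (g s, k s)) =
      ent p (fun s => (f s, g s, k s)) + ent p k)
    (h₂ : ent p (fun s => (f s, g s)) + ent p (fun s => (k s, g s)) =
      ent p (fun s => (f s, k s, g s)) + ent p g) :
    ∃ (W : Type) (_ : Fintype W) (_ : DecidableEq W) (w : B → W),
      (∀ s s', p s ≠ 0 → p s' ≠ 0 → k s = k s' → w (g s) = w (g s')) ∧
      ent p (fun s => (f s, w (g s))) + ent p (fun s => (g s, k s)) =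
        ent p (fun s => (f s, g s, k s)) + ent p (fun s => w (g s)) := by
  classical
  let law : B → A → ℝ := fun b a => marg p (fun s => (f s, g s)) (a, b) / marg p g b
  let law' : C → A → ℝ := fun c a => marg p (fun s => (f s, k s)) (a, c) / marg p k c
  have hswap : ∀ a b c, marg p (fun s => (f s, k s, g s)) (a, c, b) =
      marg p (fun s => (f s, g s, k s)) (a, b, c) := fun a b c => by
    simp only [marg, Prod.mk.injEq]
    exact congrArg (fun F => ∑ s ∈ F, p s) (by ext; simp; tauto)
  have hswap' : ∀ b c, marg p (fun s => (k s, g s)) (c, b) =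
      marg p (fun s => (g s, k s)) (b, c) := fun b c => by
    simp only [marg, Prod.mk.injEq]
    exact congrArg (fun F => ∑ s ∈ F, p s) (by ext; simp; tauto)
  have hlaw' : ∀ a b c, marg p (fun s => (f s, g s, k s)) (a, b, c) =
      marg p (fun s => (g s, k s)) (b, c) * law' c a := fun a b c => by
    rw [condIndep_of_ent_eq f g k hp h₁]; ring
  have hlaw : ∀ a b c, marg p (fun s => (f s, g s, k s)) (a, b, c) =
      marg p (fun s => (g s, k s)) (b, c) * law b a := fun a b c => by
    rw [← hswap, condIndep_of_ent_eq f k g hp h₂, hswap']; ring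
  have hagree : ∀ s, p s ≠ 0 → law (g s) = law' (k s) := fun s hs => by
    ext a
    exact mul_left_cancel₀ (marg_pos hp (fun s => (g s, k s)) ((hp s).lt_of_ne' hs)).ne'
      ((hlaw a _ _).symm.trans (hlaw' a _ _))
  let w : B → Set.range law := Set.rangeFactorization law
  have hw : ∀ b b', w b = w b' ↔ law b = law b' := fun b b' => Subtype.ext_iff
  refine ⟨Set.range law, Fintype.ofFinite _, inferInstance, w, fun s s' hs hs' h => ?_, ?_⟩
  · rw [hw, hagree s hs, hagree s' hs', h]
  let _ : Fintype (Set.range law) := Fintype.ofFinite _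
  have hfg : ∀ a b, marg p (fun s => (f s, g s)) (a, b) = marg p g b * law b a := fun a b => by
    by_cases hb : marg p g b = 0
    · rw [marg_pair_eq_zero hp hb, hb, zero_mul]
    · exact (mul_div_cancel₀ _ hb).symm
  have hfw : ∀ a b, marg p (fun s => (f s, w (g s))) (a, w b) =
      marg p (fun s => w (g s)) (w b) * law b a := fun a b => by
    -- Merging values of `g` with the same conditional law preserves that law.
    rw [← marg_marg p g w, ← marg_marg p (fun s => (f s, g s)) fun t => (t.1, w t.2)]
    simp only [marg.eq_1 (marg p g), marg.eq_1 (marg p fun s => (f s, g s)), Finset.sum_filter,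
      Fintype.sum_prod_type, Prod.mk.injEq, ite_and, Finset.sum_mul]
    rw [Finset.sum_comm]
    refine Finset.sum_congr rfl fun b' _ => ?_
    simp only [Finset.sum_ite_eq', Finset.mem_univ, if_true]
    split_ifs with h
    · rw [hfg, (hw _ _).1 h]
    · simp
  -- Since `w` is a function of `g`, appending it to `(g, k)` is injective and changes neither
  -- masses nor entropies. This matches the shape required by `ent_eq_of_condIndep`.
  let φ : B × C → (B × C) × Set.range law := fun t => (t, w t.1)
  have hφ : φ.Injective := fun t t' h => congrArg Prod.fst h
  have hψ : (Prod.map (id : A → A) φ).Injective := Function.injective_id.prodMap hφ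
  let gk : S → B × C := fun s => (g s, k s)
  have hx := fun s => marg_comp_injective hψ p (fun s => (f s, gk s)) (f s, gk s)
  have hx' := fun s => marg_comp_injective hφ p gk (gk s)
  have h0 := ent_comp_injective hψ p fun s => (f s, gk s)
  have h0' := ent_comp_injective hφ p gk
  simp only [Prod.map, id] at hx h0
  have := ent_eq_of_condIndep f gk (fun s => w (g s)) hp fun s _ => by
    rw [hx, hx', hfw, hlaw]; ring
  rwa [h0, h0'] at this

end DoubleMarkov
end CondIngleton

namespace CondIngleton

/-! ### Ingleton from auxiliary distributions: the pairs (2.1), (2.2), (2.5) -/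

section FourVariables

variable {A B C D : Type} [Fintype A] [Fintype B] [Fintype C] [Fintype D]
  [DecidableEq A] [DecidableEq B] [DecidableEq C] [DecidableEq D]

/-- Summing `p(xyz) p(xu) p(yu) / (p(xy) p(u))` over `z` cancels `p(xy)` and leaves a conditional
product given `u`, of the same total mass as `p`. Cells with `p(xy) = 0` contribute nothing, hence
only an inequality. -/
theorem sum_marg_quotient_le {p : A × B × C × D → ℝ} (hp : ∀ s, 0 ≤ p s) :
    ∑ t : A × B × C × D, marg p (fun t => (t.1, t.2.1, t.2.2.1)) (t.1, t.2.1, t.2.2.1) *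
      (marg p (fun t => (t.1, t.2.2.2)) (t.1, t.2.2.2) *
        marg p (fun t => (t.2.1, t.2.2.2)) (t.2.1, t.2.2.2)) /
      (marg p (fun t => (t.1, t.2.1)) (t.1, t.2.1) * marg p (fun t => t.2.2.2) t.2.2.2) ≤
    ∑ t, p t := by
  rw [← sum_condProd (p := p) (fun t : A × B × C × D => t.1) (fun t => t.2.1) (fun t => t.2.2.2)]
  simp only [Fintype.sum_prod_type]
  refine Finset.sum_le_sum fun x _ => Finset.sum_le_sum fun y _ => ?_
  rw [Finset.sum_comm]
  refine Finset.sum_le_sum fun u _ => ?_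
  simp only [mul_div_assoc]
  rw [← Finset.sum_mul, sum_marg_last, ← mul_div_assoc, ← mul_div_assoc]
  by_cases h : marg p (fun t => (t.1, t.2.1)) (x, y) = 0
  · rw [h]
    simp only [zero_mul, zero_div]
    exact mul_nonneg (marg_nonneg hp _ _) (div_nonneg (marg_nonneg hp _ _) (marg_nonneg hp _ _))
  · rw [mul_div_mul_left _ _ h, mul_div_assoc]

/-- The Ingleton inequality under `(X, Y)` and `(X, Y | Z)`. -/
theorem ingleton_of_xy_xyz {p : A × B × C × D → ℝ} (hp : ∀ s, 0 ≤ p s) (hp1 : ∑ s, p s = 1)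
    (h₁ : ent p (fun t => t.1) + ent p (fun t => t.2.1) = ent p fun t => (t.1, t.2.1))
    (h₂ : ent p (fun t => (t.1, t.2.2.1)) + ent p (fun t => (t.2.1, t.2.2.1)) =
      ent p (fun t => (t.1, t.2.1, t.2.2.1)) + ent p (fun t => t.2.2.1)) :
    0 ≤ ent p (fun t => (t.1, t.2.2.1)) + ent p (fun t => (t.1, t.2.2.2)) +
      ent p (fun t => (t.2.1, t.2.2.1)) + ent p (fun t => (t.2.1, t.2.2.2)) +
      ent p (fun t => (t.2.2.1, t.2.2.2)) - ent p (fun t => (t.1, t.2.1)) -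
      ent p (fun t => t.2.2.1) - ent p (fun t => t.2.2.2) -
      ent p (fun t => (t.1, t.2.2.1, t.2.2.2)) - ent p (fun t => (t.2.1, t.2.2.1, t.2.2.2)) := by
  have hXY : ∀ x y, marg p (fun t => (t.1, t.2.1)) (x, y) =
      marg p (fun t => t.1) x * marg p (fun t => t.2.1) y := fun x y => by
    -- Unconditional independence is treated as independence given a trivial variable.
    have hφ : Function.Injective fun t : A × B => (t.1, t.2, ()) :=
      fun t t' h => Prod.ext (congrArg (fun v => v.1) h) (congrArg (fun v => v.2.1) h)
    have hφ₁ : Function.Injective fun x : A => (x, ()) := fun t t' h => congrArg Prod.fst h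
    have hφ₂ : Function.Injective fun x : B => (x, ()) := fun t t' h => congrArg Prod.fst h
    have hunit : marg p (fun _ => ()) () = 1 := by simp [marg, hp1]
    have := condIndep_of_ent_eq (fun t : A × B × C × D => t.1) (fun t => t.2.1) (fun _ => ()) hp
      (by
        have e1 := ent_comp_injective hφ p fun t => (t.1, t.2.1)
        have e2 := ent_comp_injective hφ₁ p fun t => t.1
        have e3 := ent_comp_injective hφ₂ p fun t => t.2.1
        have e0 : ent p (fun _ => ()) = 0 := by simp [ent, hunit]
        linarith) x y ()
    rw [hunit, div_one] at this
    rw [← marg_comp_injective hφ, this]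
    exact congrArg₂ (· * ·) (marg_comp_injective hφ₁ p _ x) (marg_comp_injective hφ₂ p _ y)
  have hXYZ := condIndep_of_ent_eq (fun t : A × B × C × D => t.1) (fun t => t.2.1)
    (fun t => t.2.2.1) hp h₂
  -- `r` makes `X` and `Y` independent given `(Z, U)` and keeps the `XZU` and `YZU` marginals of
  -- `p`, hence all the marginals occurring in `q`.
  let r : A × B × C × D → ℝ := fun t =>
    marg p (fun t => (t.1, t.2.2.1, t.2.2.2)) (t.1, t.2.2.1, t.2.2.2) *
      marg p (fun t => (t.2.1, t.2.2.1, t.2.2.2)) (t.2.1, t.2.2.1, t.2.2.2) /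
      marg p (fun t => (t.2.2.1, t.2.2.2)) (t.2.2.1, t.2.2.2)
  have hr : ∀ t, 0 ≤ r t := fun t =>
    div_nonneg (mul_nonneg (marg_nonneg hp _ _) (marg_nonneg hp _ _)) (marg_nonneg hp _ _)
  have rXZU : ∀ t, marg r (fun t => (t.1, t.2.2.1, t.2.2.2)) t =
      marg p (fun t => (t.1, t.2.2.1, t.2.2.2)) t := fun (x, z, u) => by
    rw [marg_drop₂]
    simp only [r, ← Finset.mul_sum, ← Finset.sum_div]
    rw [sum_marg_pair p (fun t : A × B × C × D => t.2.1) (fun t => (t.2.2.1, t.2.2.2))]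
    exact mul_div_cancel_of_imp fun h => marg_pair_eq_zero hp h
  have rYZU : ∀ t, marg r (fun t => (t.2.1, t.2.2.1, t.2.2.2)) t =
      marg p (fun t => (t.2.1, t.2.2.1, t.2.2.2)) t := fun (y, z, u) => by
    rw [marg_drop₁]
    simp only [r, ← Finset.sum_mul, ← Finset.sum_div]
    rw [sum_marg_pair p (fun t : A × B × C × D => t.1) (fun t => (t.2.2.1, t.2.2.2)), mul_comm]
    exact mul_div_cancel_of_imp fun h => marg_pair_eq_zero hp h
  have rXZ : marg r (fun t => (t.1, t.2.2.1)) = marg p fun t => (t.1, t.2.2.1) :=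
    marg_comp_eq rXZU fun t => (t.1, t.2.1)
  have rXU : marg r (fun t => (t.1, t.2.2.2)) = marg p fun t => (t.1, t.2.2.2) :=
    marg_comp_eq rXZU fun t => (t.1, t.2.2)
  have rZU : marg r (fun t => (t.2.2.1, t.2.2.2)) = marg p fun t => (t.2.2.1, t.2.2.2) :=
    marg_comp_eq rXZU fun t => (t.2.1, t.2.2)
  have rYZ : marg r (fun t => (t.2.1, t.2.2.1)) = marg p fun t => (t.2.1, t.2.2.1) :=
    marg_comp_eq rYZU fun t => (t.1, t.2.1)
  have rYU : marg r (fun t => (t.2.1, t.2.2.2)) = marg p fun t => (t.2.1, t.2.2.2) :=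
    marg_comp_eq rYZU fun t => (t.1, t.2.2)
  have rX : marg r (fun t => t.1) = marg p fun t => t.1 := marg_comp_eq rXZU fun t => t.1
  have rY : marg r (fun t => t.2.1) = marg p fun t => t.2.1 := marg_comp_eq rYZU fun t => t.1
  have rZ : marg r (fun t => t.2.2.1) = marg p fun t => t.2.2.1 :=
    marg_comp_eq rXZU fun t => t.2.1
  have rU : marg r (fun t => t.2.2.2) = marg p fun t => t.2.2.2 :=
    marg_comp_eq rXZU fun t => t.2.2
  let q : A × B × C × D → ℝ := fun t =>
    (marg p (fun t => (t.1, t.2.2.1)) (t.1, t.2.2.1) *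
      marg p (fun t => (t.2.1, t.2.2.1)) (t.2.1, t.2.2.1) / marg p (fun t => t.2.2.1) t.2.2.1) *
      (marg p (fun t => (t.1, t.2.2.2)) (t.1, t.2.2.2) *
        marg p (fun t => (t.2.1, t.2.2.2)) (t.2.1, t.2.2.2)) /
      (marg p (fun t => t.1) t.1 * marg p (fun t => t.2.1) t.2.1 *
        marg p (fun t => t.2.2.2) t.2.2.2)
  have hpos : ∀ {T : Type} [DecidableEq T] {f : A × B × C × D → T} (_ : marg r f = marg p f) {t},
      0 < r t → 0 < marg p f (f t) := fun h _ ht => h ▸ marg_pos hr _ ht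
  have hlog : ∀ t, 0 < r t → 0 < q t ∧ Real.log (r t) - Real.log (q t) =
      Real.log (marg p (fun t => (t.1, t.2.2.1, t.2.2.2)) (t.1, t.2.2.1, t.2.2.2)) +
      Real.log (marg p (fun t => (t.2.1, t.2.2.1, t.2.2.2)) (t.2.1, t.2.2.1, t.2.2.2)) -
      Real.log (marg p (fun t => (t.2.2.1, t.2.2.2)) (t.2.2.1, t.2.2.2)) -
      Real.log (marg p (fun t => (t.1, t.2.2.1)) (t.1, t.2.2.1)) -
      Real.log (marg p (fun t => (t.2.1, t.2.2.1)) (t.2.1, t.2.2.1)) +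
      Real.log (marg p (fun t => t.2.2.1) t.2.2.1) -
      Real.log (marg p (fun t => (t.1, t.2.2.2)) (t.1, t.2.2.2)) -
      Real.log (marg p (fun t => (t.2.1, t.2.2.2)) (t.2.1, t.2.2.2)) +
      Real.log (marg p (fun t => t.2.2.2) t.2.2.2) +
      Real.log (marg p (fun t => t.1) t.1) + Real.log (marg p (fun t => t.2.1) t.2.1) :=
    fun t ht => by
      have a1 := hpos (funext rXZU) ht
      have a2 := hpos (funext rYZU) ht
      have a3 := hpos rZU ht
      have a4 := hpos rXZ ht
      have a5 := hpos rYZ ht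
      have a6 := hpos rZ ht
      have a7 := hpos rXU ht
      have a8 := hpos rYU ht
      have a9 := hpos rU ht
      have a10 := hpos rX ht
      have a11 := hpos rY ht
      refine ⟨by positivity, ?_⟩
      rw [Real.log_div (by positivity) (by positivity),
        Real.log_div (by positivity) (by positivity), Real.log_mul a1.ne' a2.ne',
        Real.log_mul (by positivity) (by positivity), Real.log_div (by positivity) a6.ne',
        Real.log_mul a4.ne' a5.ne', Real.log_mul a7.ne' a8.ne',
        Real.log_mul (by positivity) a9.ne', Real.log_mul a10.ne' a11.ne']
      ring
  have hq : ∀ t, 0 ≤ q t := fun t => div_nonneg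
    (mul_nonneg (div_nonneg (mul_nonneg (marg_nonneg hp _ _) (marg_nonneg hp _ _))
      (marg_nonneg hp _ _)) (mul_nonneg (marg_nonneg hp _ _) (marg_nonneg hp _ _)))
    (mul_nonneg (mul_nonneg (marg_nonneg hp _ _) (marg_nonneg hp _ _)) (marg_nonneg hp _ _))
  have hle : ∑ t, q t ≤ ∑ t, r t := by
    rw [← sum_marg r fun t => (t.1, t.2.2.1, t.2.2.2), funext rXZU, sum_marg]
    -- The assumptions enter here: they rewrite `q` as `p(xyz) p(xu) p(yu) / (p(xy) p(u))`.
    simpa only [q, ← hXYZ, ← hXY] using sum_marg_quotient_le hp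
  have key := gibbs_of_log hr hq hle hlog
  simp only [mul_add, mul_sub, Finset.sum_add_distrib, Finset.sum_sub_distrib,
    negMulLog_marg_cross (funext rXZU), negMulLog_marg_cross (funext rYZU),
    negMulLog_marg_cross rZU, negMulLog_marg_cross rXZ, negMulLog_marg_cross rYZ,
    negMulLog_marg_cross rZ, negMulLog_marg_cross rXU, negMulLog_marg_cross rYU,
    negMulLog_marg_cross rU, negMulLog_marg_cross rX, negMulLog_marg_cross rY] at key
  linarith

/-- The Ingleton inequality under `(X, Y | Z)` and `(Y, U | Z)`. -/
theorem ingleton_of_xyz_yuz {p : A × B × C × D → ℝ} (hp : ∀ s, 0 ≤ p s)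
    (h₁ : ent p (fun t => (t.1, t.2.2.1)) + ent p (fun t => (t.2.1, t.2.2.1)) =
      ent p (fun t => (t.1, t.2.1, t.2.2.1)) + ent p (fun t => t.2.2.1))
    (h₂ : ent p (fun t => (t.2.1, t.2.2.1)) + ent p (fun t => (t.2.2.2, t.2.2.1)) =
      ent p (fun t => (t.2.1, t.2.2.2, t.2.2.1)) + ent p (fun t => t.2.2.1)) :
    0 ≤ ent p (fun t => (t.1, t.2.2.2)) + ent p (fun t => (t.2.1, t.2.2.2)) +
      ent p (fun t => (t.1, t.2.2.1)) - ent p (fun t => (t.1, t.2.1)) -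
      ent p (fun t => t.2.2.2) - ent p (fun t => (t.1, t.2.2.2, t.2.2.1)) := by
  have hXYZ := condIndep_of_ent_eq (fun t : A × B × C × D => t.1) (fun t => t.2.1)
    (fun t => t.2.2.1) hp h₁
  have hYUZ := condIndep_of_ent_eq (fun t : A × B × C × D => t.2.1) (fun t => t.2.2.2)
    (fun t => t.2.2.1) hp h₂
  -- `r` makes `Y` independent of `(X, U)` given `Z`. The two assumptions are exactly what preserves
  -- its `XYZ` and `YZU` marginals.
  let r : A × B × C × D → ℝ := fun t =>
    marg p (fun t => (t.1, t.2.2.2, t.2.2.1)) (t.1, t.2.2.2, t.2.2.1) *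
      marg p (fun t => (t.2.1, t.2.2.1)) (t.2.1, t.2.2.1) / marg p (fun t => t.2.2.1) t.2.2.1
  have hr : ∀ t, 0 ≤ r t := fun t =>
    div_nonneg (mul_nonneg (marg_nonneg hp _ _) (marg_nonneg hp _ _)) (marg_nonneg hp _ _)
  have rXUZ : ∀ t, marg r (fun t => (t.1, t.2.2.2, t.2.2.1)) t =
      marg p (fun t => (t.1, t.2.2.2, t.2.2.1)) t := fun (x, u, z) => by
    rw [marg_drop₂']
    simp only [r, ← Finset.mul_sum, ← Finset.sum_div]
    rw [sum_marg_pair p (fun t : A × B × C × D => t.2.1) (fun t => t.2.2.1)]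
    exact mul_div_cancel_of_imp fun h => marg_pair_eq_zero hp (marg_pair_eq_zero hp h)
  have rYUZ : ∀ t, marg r (fun t => (t.2.1, t.2.2.2, t.2.2.1)) t =
      marg p (fun t => (t.2.1, t.2.2.2, t.2.2.1)) t := fun (y, u, z) => by
    rw [marg_drop₁']
    simp only [r, ← Finset.sum_mul, ← Finset.sum_div]
    rw [sum_marg_pair p (fun t : A × B × C × D => t.1) (fun t => (t.2.2.2, t.2.2.1)), hYUZ,
      mul_comm]
  have rXYZ : ∀ t, marg r (fun t => (t.1, t.2.1, t.2.2.1)) t =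
      marg p (fun t => (t.1, t.2.1, t.2.2.1)) t := fun (x, y, z) => by
    rw [marg_drop₄]
    simp only [r, ← Finset.sum_mul, ← Finset.sum_div]
    rw [sum_marg_mid p (fun t : A × B × C × D => t.1) (fun t => t.2.2.2) (fun t => t.2.2.1),
      hXYZ]
  have rXU : marg r (fun t => (t.1, t.2.2.2)) = marg p fun t => (t.1, t.2.2.2) :=
    marg_comp_eq rXUZ fun t => (t.1, t.2.1)
  have rYU : marg r (fun t => (t.2.1, t.2.2.2)) = marg p fun t => (t.2.1, t.2.2.2) :=
    marg_comp_eq rYUZ fun t => (t.1, t.2.1)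
  have rYZ : marg r (fun t => (t.2.1, t.2.2.1)) = marg p fun t => (t.2.1, t.2.2.1) :=
    marg_comp_eq rYUZ fun t => (t.1, t.2.2)
  have rXY : marg r (fun t => (t.1, t.2.1)) = marg p fun t => (t.1, t.2.1) :=
    marg_comp_eq rXYZ fun t => (t.1, t.2.1)
  have rZ : marg r (fun t => t.2.2.1) = marg p fun t => t.2.2.1 :=
    marg_comp_eq rXUZ fun t => t.2.2
  have rU : marg r (fun t => t.2.2.2) = marg p fun t => t.2.2.2 :=
    marg_comp_eq rXUZ fun t => t.2.1
  let q : A × B × C × D → ℝ := fun t =>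
    marg p (fun t => (t.1, t.2.1, t.2.2.1)) (t.1, t.2.1, t.2.2.1) *
      (marg p (fun t => (t.1, t.2.2.2)) (t.1, t.2.2.2) *
        marg p (fun t => (t.2.1, t.2.2.2)) (t.2.1, t.2.2.2)) /
      (marg p (fun t => (t.1, t.2.1)) (t.1, t.2.1) * marg p (fun t => t.2.2.2) t.2.2.2)
  have hpos : ∀ {T : Type} [DecidableEq T] {f : A × B × C × D → T} (_ : marg r f = marg p f) {t},
      0 < r t → 0 < marg p f (f t) := fun h _ ht => h ▸ marg_pos hr _ ht
  have hlog : ∀ t, 0 < r t → 0 < q t ∧ Real.log (r t) - Real.log (q t) =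
      Real.log (marg p (fun t => (t.1, t.2.2.2, t.2.2.1)) (t.1, t.2.2.2, t.2.2.1)) +
      Real.log (marg p (fun t => (t.2.1, t.2.2.1)) (t.2.1, t.2.2.1)) -
      Real.log (marg p (fun t => t.2.2.1) t.2.2.1) -
      Real.log (marg p (fun t => (t.1, t.2.1, t.2.2.1)) (t.1, t.2.1, t.2.2.1)) -
      Real.log (marg p (fun t => (t.1, t.2.2.2)) (t.1, t.2.2.2)) -
      Real.log (marg p (fun t => (t.2.1, t.2.2.2)) (t.2.1, t.2.2.2)) +
      Real.log (marg p (fun t => (t.1, t.2.1)) (t.1, t.2.1)) +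
      Real.log (marg p (fun t => t.2.2.2) t.2.2.2) :=
    fun t ht => by
      have a1 := hpos (funext rXUZ) ht
      have a2 := hpos rYZ ht
      have a3 := hpos rZ ht
      have a4 := hpos (funext rXYZ) ht
      have a5 := hpos rXU ht
      have a6 := hpos rYU ht
      have a7 := hpos rXY ht
      have a8 := hpos rU ht
      refine ⟨by positivity, ?_⟩
      rw [Real.log_div (by positivity) a3.ne', Real.log_div (by positivity) (by positivity),
        Real.log_mul a1.ne' a2.ne', Real.log_mul a4.ne' (by positivity),
        Real.log_mul a5.ne' a6.ne', Real.log_mul a7.ne' a8.ne']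
      ring
  have hq : ∀ t, 0 ≤ q t := fun t => div_nonneg
    (mul_nonneg (marg_nonneg hp _ _) (mul_nonneg (marg_nonneg hp _ _) (marg_nonneg hp _ _)))
    (mul_nonneg (marg_nonneg hp _ _) (marg_nonneg hp _ _))
  have hle : ∑ t, q t ≤ ∑ t, r t := by
    rw [← sum_marg r fun t => (t.1, t.2.2.2, t.2.2.1), funext rXUZ, sum_marg]
    exact sum_marg_quotient_le hp
  have key := gibbs_of_log hr hq hle hlog
  simp only [mul_add, mul_sub, Finset.sum_add_distrib, Finset.sum_sub_distrib,
    negMulLog_marg_cross (funext rXUZ), negMulLog_marg_cross (funext rXYZ),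
    negMulLog_marg_cross rYZ, negMulLog_marg_cross rZ, negMulLog_marg_cross rXU,
    negMulLog_marg_cross rYU, negMulLog_marg_cross rXY, negMulLog_marg_cross rU] at key
  linarith

/-- The Ingleton inequality under `(X, Z | U)` and `(Y, Z | U)`. -/
theorem ingleton_of_xzu_yzu {p : A × B × C × D → ℝ} (hp : ∀ s, 0 ≤ p s)
    (h₁ : ent p (fun t => (t.1, t.2.2.2)) + ent p (fun t => (t.2.2.1, t.2.2.2)) =
      ent p (fun t => (t.1, t.2.2.1, t.2.2.2)) + ent p (fun t => t.2.2.2))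
    (h₂ : ent p (fun t => (t.2.1, t.2.2.2)) + ent p (fun t => (t.2.2.1, t.2.2.2)) =
      ent p (fun t => (t.2.1, t.2.2.1, t.2.2.2)) + ent p (fun t => t.2.2.2)) :
    0 ≤ ent p (fun t => (t.1, t.2.2.1)) + ent p (fun t => (t.2.1, t.2.2.1)) +
      ent p (fun t => t.2.2.2) - ent p (fun t => (t.1, t.2.1)) -
      ent p (fun t => t.2.2.1) - ent p (fun t => (t.2.2.1, t.2.2.2)) := by
  have hXZU := condIndep_of_ent_eq (fun t : A × B × C × D => t.1) (fun t => t.2.2.1)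
    (fun t => t.2.2.2) hp h₁
  have hYZU := condIndep_of_ent_eq (fun t : A × B × C × D => t.2.1) (fun t => t.2.2.1)
    (fun t => t.2.2.2) hp h₂
  -- `r` makes `Z` independent of `(X, Y)` given `U`. The assumptions preserve its `XZU` and `YZU`
  -- marginals. The factor `p(xyu)`, shared with `q` below, cancels in the log ratio.
  let r : A × B × C × D → ℝ := fun t =>
    marg p (fun t => (t.1, t.2.1, t.2.2.2)) (t.1, t.2.1, t.2.2.2) *
      marg p (fun t => (t.2.2.1, t.2.2.2)) (t.2.2.1, t.2.2.2) / marg p (fun t => t.2.2.2) t.2.2.2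
  have hr : ∀ t, 0 ≤ r t := fun t =>
    div_nonneg (mul_nonneg (marg_nonneg hp _ _) (marg_nonneg hp _ _)) (marg_nonneg hp _ _)
  have rXYU : ∀ t, marg r (fun t => (t.1, t.2.1, t.2.2.2)) t =
      marg p (fun t => (t.1, t.2.1, t.2.2.2)) t := fun (x, y, u) => by
    rw [marg_drop₃]
    simp only [r, ← Finset.mul_sum, ← Finset.sum_div]
    rw [sum_marg_pair p (fun t : A × B × C × D => t.2.2.1) (fun t => t.2.2.2)]
    exact mul_div_cancel_of_imp fun h => marg_pair_eq_zero hp (marg_pair_eq_zero hp h)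
  have rXZU : ∀ t, marg r (fun t => (t.1, t.2.2.1, t.2.2.2)) t =
      marg p (fun t => (t.1, t.2.2.1, t.2.2.2)) t := fun (x, z, u) => by
    rw [marg_drop₂]
    simp only [r, ← Finset.sum_mul, ← Finset.sum_div]
    rw [sum_marg_mid p (fun t : A × B × C × D => t.1) (fun t => t.2.1) (fun t => t.2.2.2), hXZU]
  have rYZU : ∀ t, marg r (fun t => (t.2.1, t.2.2.1, t.2.2.2)) t =
      marg p (fun t => (t.2.1, t.2.2.1, t.2.2.2)) t := fun (y, z, u) => by
    rw [marg_drop₁]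
    simp only [r, ← Finset.sum_mul, ← Finset.sum_div]
    rw [sum_marg_pair p (fun t : A × B × C × D => t.1) (fun t => (t.2.1, t.2.2.2)), hYZU]
  have rXY : marg r (fun t => (t.1, t.2.1)) = marg p fun t => (t.1, t.2.1) :=
    marg_comp_eq rXYU fun t => (t.1, t.2.1)
  have rXZ : marg r (fun t => (t.1, t.2.2.1)) = marg p fun t => (t.1, t.2.2.1) :=
    marg_comp_eq rXZU fun t => (t.1, t.2.1)
  have rYZ : marg r (fun t => (t.2.1, t.2.2.1)) = marg p fun t => (t.2.1, t.2.2.1) :=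
    marg_comp_eq rYZU fun t => (t.1, t.2.1)
  have rZU : marg r (fun t => (t.2.2.1, t.2.2.2)) = marg p fun t => (t.2.2.1, t.2.2.2) :=
    marg_comp_eq rXZU fun t => (t.2.1, t.2.2)
  have rZ : marg r (fun t => t.2.2.1) = marg p fun t => t.2.2.1 :=
    marg_comp_eq rXZU fun t => t.2.1
  have rU : marg r (fun t => t.2.2.2) = marg p fun t => t.2.2.2 :=
    marg_comp_eq rXZU fun t => t.2.2
  let q : A × B × C × D → ℝ := fun t =>
    marg p (fun t => (t.1, t.2.1, t.2.2.2)) (t.1, t.2.1, t.2.2.2) *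
      (marg p (fun t => (t.1, t.2.2.1)) (t.1, t.2.2.1) *
        marg p (fun t => (t.2.1, t.2.2.1)) (t.2.1, t.2.2.1) / marg p (fun t => t.2.2.1) t.2.2.1 /
      marg p (fun t => (t.1, t.2.1)) (t.1, t.2.1))
  have hpos : ∀ {T : Type} [DecidableEq T] {f : A × B × C × D → T} (_ : marg r f = marg p f) {t},
      0 < r t → 0 < marg p f (f t) := fun h _ ht => h ▸ marg_pos hr _ ht
  have hlog : ∀ t, 0 < r t → 0 < q t ∧ Real.log (r t) - Real.log (q t) =
      Real.log (marg p (fun t => (t.2.2.1, t.2.2.2)) (t.2.2.1, t.2.2.2)) -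
      Real.log (marg p (fun t => t.2.2.2) t.2.2.2) -
      Real.log (marg p (fun t => (t.1, t.2.2.1)) (t.1, t.2.2.1)) -
      Real.log (marg p (fun t => (t.2.1, t.2.2.1)) (t.2.1, t.2.2.1)) +
      Real.log (marg p (fun t => t.2.2.1) t.2.2.1) +
      Real.log (marg p (fun t => (t.1, t.2.1)) (t.1, t.2.1)) :=
    fun t ht => by
      have a1 := hpos (funext rXYU) ht
      have a2 := hpos rZU ht
      have a3 := hpos rU ht
      have a4 := hpos rXZ ht
      have a5 := hpos rYZ ht
      have a6 := hpos rZ ht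
      have a7 := hpos rXY ht
      refine ⟨by positivity, ?_⟩
      rw [Real.log_div (by positivity) a3.ne', Real.log_mul a1.ne' a2.ne',
        Real.log_mul a1.ne' (by positivity), Real.log_div (by positivity) a7.ne',
        Real.log_div (by positivity) a6.ne', Real.log_mul a4.ne' a5.ne']
      ring
  have hq : ∀ t, 0 ≤ q t := fun t => mul_nonneg (marg_nonneg hp _ _) (div_nonneg (div_nonneg
    (mul_nonneg (marg_nonneg hp _ _) (marg_nonneg hp _ _)) (marg_nonneg hp _ _))
    (marg_nonneg hp _ _))
  have hle : ∑ t, q t ≤ ∑ t, r t := by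
    rw [← sum_marg r fun t => (t.1, t.2.1, t.2.2.2), funext rXYU, sum_marg,
      ← sum_condProd (p := p) (fun t : A × B × C × D => t.1) (fun t => t.2.1) (fun t => t.2.2.1)]
    simp only [q, Fintype.sum_prod_type]
    refine Finset.sum_le_sum fun x _ => Finset.sum_le_sum fun y _ => Finset.sum_le_sum fun z _ => ?_
    rw [← Finset.sum_mul, sum_marg_last]
    by_cases h : marg p (fun t => (t.1, t.2.1)) (x, y) = 0
    · rw [h, zero_mul]
      exact div_nonneg (mul_nonneg (marg_nonneg hp _ _) (marg_nonneg hp _ _))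
        (marg_nonneg hp _ _)
    · rw [mul_div_cancel₀ _ h]
  have key := gibbs_of_log hr hq hle hlog
  simp only [mul_add, mul_sub, Finset.sum_add_distrib, Finset.sum_sub_distrib,
    negMulLog_marg_cross rZU, negMulLog_marg_cross rU, negMulLog_marg_cross rXZ,
    negMulLog_marg_cross rYZ, negMulLog_marg_cross rZ, negMulLog_marg_cross rXY] at key
  linarith

end FourVariables
end CondIngleton

namespace CondIngleton

/-! ### Entropy vectors and mass functions -/

theorem IsEntropic.exists_pmf {h : Finset Var → ℝ} (hh : IsEntropic h) :
    ∃ (q : Var → ℕ) (p : ((v : Var) → Fin (q v)) → ℝ), (∀ s, 0 ≤ p s) ∧ ∑ s, p s = 1 ∧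
      ∀ I : Finset Var, h I = ent p fun s (v : I) => s v := by
  obtain ⟨Ω, _, μ, _, q, ξ, hξ, rfl⟩ := hh
  have hm : Measurable fun ω v => ξ v ω := measurable_pi_lambda _ hξ
  let ν := μ.map fun ω v => ξ v ω
  have : IsProbabilityMeasure ν := Measure.isProbabilityMeasure_map hm.aemeasurable
  refine ⟨q, fun s => ν.real {s}, fun s => measureReal_nonneg, ?_, fun I => ?_⟩
  · rw [sum_measureReal_singleton, Finset.coe_univ, probReal_univ]
  · refine Finset.sum_congr rfl fun t _ => ?_
    rw [marg, sum_measureReal_singleton, map_measureReal_apply hm (Set.toFinite _).measurableSet]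
    congr 2
    ext ω
    simp

theorem exists_measure {S : Type} [Fintype S] {p : S → ℝ} (hp : ∀ s, 0 ≤ p s)
    (hp1 : ∑ s, p s = 1) : ∃ (_ : MeasurableSpace S) (μ : Measure S) (_ : IsProbabilityMeasure μ),
      (∀ A : Set S, MeasurableSet A) ∧ ∀ {T : Type} [DecidableEq T] (f : S → T) (t : T),
        μ.real (f ⁻¹' {t}) = marg p f t := by
  classical
  let m : MeasurableSpace S := ⊤
  let P := PMF.ofFintype (fun s => ENNReal.ofReal (p s)) (by
    rw [← ENNReal.ofReal_sum_of_nonneg fun s _ => hp s, hp1, ENNReal.ofReal_one])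
  refine ⟨m, P.toMeasure, inferInstance, fun _ => trivial, fun f t => ?_⟩
  rw [measureReal_def, PMF.toMeasure_apply_fintype, marg,
    ENNReal.toReal_sum (by intro s _; simp [Set.indicator]; split_ifs <;> simp [P]),
    Finset.sum_filter]
  refine Finset.sum_congr rfl fun s _ => ?_
  by_cases h : f s = t <;> simp [Set.indicator, h, P, hp s]

theorem isEntropic_of_pmf {S : Type} [Fintype S] {p : S → ℝ} (hp : ∀ s, 0 ≤ p s)
    (hp1 : ∑ s, p s = 1) {q : Var → ℕ} (ξ : (v : Var) → S → Fin (q v)) :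
    IsEntropic fun I => ent p fun s (v : I) => ξ v s := by
  obtain ⟨m, μ, hμ, hmeas, hreal⟩ := exists_measure hp hp1
  refine ⟨S, m, μ, hμ, q, ξ, fun v _ _ => hmeas _, ?_⟩
  ext I
  exact Finset.sum_congr rfl fun t _ => by rw [hreal]

theorem isBinaryEntropic_of_pmf {S : Type} [Fintype S] {p : S → ℝ} (hp : ∀ s, 0 ≤ p s)
    (hp1 : ∑ s, p s = 1) (ξ : Var → S → Fin 2) (P : Fin 2 → Fin 2 → Fin 2 → Fin 2 → ℝ)
    (hP : ∀ i j k l, marg p (fun s => (ξ Var.X s, ξ Var.Y s, ξ Var.Z s, ξ Var.U s)) (i, j, k, l) =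
      P i j k l) :
    IsBinaryEntropic P fun I => ent p fun s (v : I) => ξ v s := by
  obtain ⟨m, μ, hμ, hmeas, hreal⟩ := exists_measure hp hp1
  refine ⟨S, m, μ, hμ, ξ, fun v _ _ => hmeas _, fun i j k l => ?_, ?_⟩
  · rw [← hP, ← hreal]
    congr 1
    ext s
    simp
  · ext I
    exact Finset.sum_congr rfl fun t _ => by rw [hreal]

/-- Replaces functions on a dependent index set by tuples: any `f` separating states exactly as the
coordinates in `I` do may represent `h I`, in whatever order suits the lemma applied next. -/
theorem IsEntropic.exists_ent {h : Finset Var → ℝ} (hh : IsEntropic h) :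
    ∃ (A B C D : Type) (_ : Fintype A) (_ : Fintype B) (_ : Fintype C) (_ : Fintype D)
      (_ : DecidableEq A) (_ : DecidableEq B) (_ : DecidableEq C) (_ : DecidableEq D)
      (p : A × B × C × D → ℝ), (∀ s, 0 ≤ p s) ∧ ∑ s, p s = 1 ∧
      ∀ (I : Finset Var) {T : Type} [Fintype T] [DecidableEq T] (f : A × B × C × D → T),
        (∀ s s', ((Var.X ∈ I → s.1 = s'.1) ∧ (Var.Y ∈ I → s.2.1 = s'.2.1) ∧
          (Var.Z ∈ I → s.2.2.1 = s'.2.2.1) ∧ (Var.U ∈ I → s.2.2.2 = s'.2.2.2)) ↔ f s = f s') →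
        h I = ent p f := by
  obtain ⟨q, p, hp, hp1, hI⟩ := hh.exists_pmf
  let F : ((v : Var) → Fin (q v)) → Fin (q .X) × Fin (q .Y) × Fin (q .Z) × Fin (q .U) :=
    fun s => (s .X, s .Y, s .Z, s .U)
  refine ⟨Fin (q .X), Fin (q .Y), Fin (q .Z), Fin (q .U), inferInstance, inferInstance,
    inferInstance, inferInstance, inferInstance, inferInstance, inferInstance, inferInstance,
    marg p F, marg_nonneg hp F, (sum_marg p F).trans hp1, fun I T _ _ f hf => ?_⟩
  rw [hI, ent_marg]
  refine ent_congr fun s s' _ _ => ?_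
  rw [← hf]
  constructor
  · intro h
    have h' : ∀ v ∈ I, s v = s' v := fun v hv => congrFun h ⟨v, hv⟩
    exact ⟨h' _, h' _, h' _, h' _⟩
  · rintro ⟨hX, hY, hZ, hU⟩
    ext ⟨v, hv⟩
    cases v
    · exact congrArg _ (hX hv)
    · exact congrArg _ (hY hv)
    · exact congrArg _ (hZ hv)
    · exact congrArg _ (hU hv)

theorem IsEntropic.submodular {h : Finset Var → ℝ} (hh : IsEntropic h) (I J K L : Finset Var)
    (hK : K = I ∪ J := by decide) (hL : L = I ∩ J := by decide) : h K + h L ≤ h I + h J := by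
  subst hK hL
  obtain ⟨q, p, hp, -, hI⟩ := hh.exists_pmf
  have e : ∀ {T : Type} [Fintype T] [DecidableEq T] (f : _ → T) (I : Finset Var),
      (∀ s s', (∀ v ∈ I, s v = s' v) ↔ f s = f s') → h I = ent p f := fun f I hf => by
    rw [hI]
    refine ent_congr fun s s' _ _ => ?_
    rw [← hf, funext_iff]
    exact ⟨fun h v hv => h ⟨v, hv⟩, fun h v => h v v.2⟩
  have := ent_submodular (p := p) (fun s (v : I) => s v) (fun s (v : J) => s v)
    (fun s (v : ↥(I ∩ J)) => s v) hp
  rwa [← e (fun s => ((fun v : I => s v), (fun v : J => s v), fun v : ↥(I ∩ J) => s v)) (I ∪ J),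
    ← e (fun s (v : ↥(I ∩ J)) => s v) (I ∩ J), ← e (fun s => ((fun v : I => s v),
      fun v : ↥(I ∩ J) => s v)) I, ← e (fun s => ((fun v : J => s v),
      fun v : ↥(I ∩ J) => s v)) J] at this
  all_goals
    intro s s'
    simp only [Prod.mk.injEq, funext_iff, Subtype.forall, Finset.mem_union, Finset.mem_inter] <;>
    grind

theorem IsEntropic.apply_empty {h : Finset Var → ℝ} (hh : IsEntropic h) : h ∅ = 0 := by
  obtain ⟨q, p, hp, hp1, hI⟩ := hh.exists_pmf
  rw [hI, ent]
  simp [marg, Finset.filter_true_of_mem fun s _ => Subsingleton.elim _ _, hp1]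

theorem IsEntropic.map {h : Finset Var → ℝ} (hh : IsEntropic h) (σ : Equiv.Perm Var) :
    IsEntropic fun I => h (I.map σ.toEmbedding) := by
  obtain ⟨q, p, hp, hp1, hI⟩ := hh.exists_pmf
  have := isEntropic_of_pmf hp hp1 (q := fun v => q (σ v)) fun v s => s (σ v)
  convert this using 2 with I
  rw [hI]
  refine ent_congr fun s s' _ _ => ?_
  simp only [funext_iff, Subtype.forall, Finset.mem_map]
  constructor
  · intro h v hv
    exact h _ ⟨v, hv, rfl⟩
  · rintro h _ ⟨v, hv, rfl⟩
    exact h v hv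

end CondIngleton

namespace CondIngleton

/-! ### Conditional Ingleton inequalities -/

open Var

theorem delta_ci_eq {i j : Var} {K : Finset Var} {hij : i ≠ j ∧ i ∉ K ∧ j ∉ K}
    (h : Finset Var → ℝ) (I J L : Finset Var) (hI : {i} ∪ K = I := by decide)
    (hJ : {j} ∪ K = J := by decide) (hL : {i, j} ∪ K = L := by decide) :
    delta (ci i j K hij) h = h I + h J - h L - h K := by
  rw [delta_ci, hI, hJ, hL]

/-- In each case the left side is a sum of three conditional mutual informations. For instance,
adding `I(Z;U)` to Ingleton gives `I(Z;U|X) + I(Z;U|Y) + I(X;Y)`. -/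
theorem ingleton_add_delta_nonneg {a : Fin 5} {c : ElemCI} (hc : c ∈ single a)
    {h : Finset Var → ℝ} (hh : IsEntropic h) : 0 ≤ ingleton h + delta c h := by
  have h0 := hh.apply_empty
  fin_cases a <;> simp [single] at hc <;> subst hc <;> rw [ingleton]
  · rw [delta_ci_eq h {Z} {U} {Z, U}]
    have := hh.submodular {X, Z} {X, U} {X, Z, U} {X}
    have := hh.submodular {Y, Z} {Y, U} {Y, Z, U} {Y}
    have := hh.submodular {X} {Y} {X, Y} ∅
    linarith
  · rw [delta_ci_eq h {X} {Z} {X, Z}]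
    have := hh.submodular {X, U} {Z, U} {X, Z, U} {U}
    have := hh.submodular {Y, Z} {Y, U} {Y, Z, U} {Y}
    have := hh.submodular {X} {Y} {X, Y} ∅
    linarith
  · rw [delta_ci_eq h {X, Y} {Y, Z} {X, Y, Z}]
    have := hh.submodular {X, U} {Z, U} {X, Z, U} {U}
    have := hh.submodular {Y, Z} {Y, U} {Y, Z, U} {Y}
    have := hh.submodular {X, Z} {Y, Z} {X, Y, Z} {Z}
    linarith
  · rw [delta_ci_eq h {X, Z, U} {Y, Z, U} {X, Y, Z, U}]
    have := hh.submodular {X, Z} {Y, Z} {X, Y, Z} {Z}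
    have := hh.submodular {X, U} {Y, U} {X, Y, U} {U}
    have := hh.submodular {X, Y, Z} {X, Y, U} {X, Y, Z, U} {X, Y}
    linarith
  · rw [delta_ci_eq h {X, Y, U} {Y, Z, U} {X, Y, Z, U}]
    have := hh.submodular {X, Z} {Y, Z} {X, Y, Z} {Z}
    have := hh.submodular {X, U} {Z, U} {X, Z, U} {U}
    have := hh.submodular {X, Y, Z} {X, Y, U} {X, Y, Z, U} {X, Y}
    linarith

theorem exists_single_eq (a : Fin 5) : ∃ c, single a = {c} := by
  fin_cases a <;> exact ⟨_, rfl⟩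

theorem not_essentiallyConditional_single (a : Fin 5) : ¬ EssentiallyConditional (single a) := by
  obtain ⟨c, hc⟩ := exists_single_eq a
  refine not_not_intro ⟨fun _ => 1, fun _ _ => zero_le_one, fun h hh => ?_⟩
  rw [hc, Finset.sum_singleton, one_mul]
  exact ingleton_add_delta_nonneg (a := a) (by simp [hc]) hh

theorem impliesIngleton_single (a : Fin 5) : ImpliesIngleton (single a) := by
  obtain ⟨c, hc⟩ := exists_single_eq a
  intro h hh hL
  have hc' : c ∈ single a := by simp [hc]
  simpa [hL c hc'] using ingleton_add_delta_nonneg hc' hh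

theorem impliesIngleton_double_zero : ImpliesIngleton (double 0) := by
  intro h hh hL
  simp only [double, Matrix.cons_val_zero, Finset.mem_insert, Finset.mem_singleton,
    forall_eq_or_imp, forall_eq] at hL
  rw [delta_ci_eq h {X} {Y} {X, Y}, delta_ci_eq h {X, Z} {Y, Z} {X, Y, Z}] at hL
  have h0 := hh.apply_empty
  obtain ⟨A, B, C, D, _, _, _, _, _, _, _, _, p, hp, hp1, hI⟩ := hh.exists_ent
  have eX := hI {X} (fun t => t.1) fun _ _ => by simp
  have eY := hI {Y} (fun t => t.2.1) fun _ _ => by simp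
  have eZ := hI {Z} (fun t => t.2.2.1) fun _ _ => by simp
  have eU := hI {U} (fun t => t.2.2.2) fun _ _ => by simp
  have eXY := hI {X, Y} (fun t => (t.1, t.2.1)) fun _ _ => by simp [Prod.ext_iff]
  have eXZ := hI {X, Z} (fun t => (t.1, t.2.2.1)) fun _ _ => by simp [Prod.ext_iff]
  have eXU := hI {X, U} (fun t => (t.1, t.2.2.2)) fun _ _ => by simp [Prod.ext_iff]
  have eYZ := hI {Y, Z} (fun t => (t.2.1, t.2.2.1)) fun _ _ => by simp [Prod.ext_iff]
  have eYU := hI {Y, U} (fun t => (t.2.1, t.2.2.2)) fun _ _ => by simp [Prod.ext_iff]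
  have eZU := hI {Z, U} (fun t => (t.2.2.1, t.2.2.2)) fun _ _ => by simp [Prod.ext_iff]
  have eXYZ := hI {X, Y, Z} (fun t => (t.1, t.2.1, t.2.2.1)) fun _ _ => by simp [Prod.ext_iff]
  have eXZU := hI {X, Z, U} (fun t => (t.1, t.2.2.1, t.2.2.2)) fun _ _ => by simp [Prod.ext_iff]
  have eYZU := hI {Y, Z, U} (fun t => (t.2.1, t.2.2.1, t.2.2.2)) fun _ _ => by simp [Prod.ext_iff]
  have := ingleton_of_xy_xyz hp hp1 (by linarith) (by linarith)
  rw [ingleton]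
  linarith

theorem impliesIngleton_double_one : ImpliesIngleton (double 1) := by
  intro h hh hL
  simp only [double, Matrix.cons_val_one, Matrix.cons_val_zero, Finset.mem_insert,
    Finset.mem_singleton, forall_eq_or_imp, forall_eq] at hL
  rw [delta_ci_eq h {X, Z} {Y, Z} {X, Y, Z}, delta_ci_eq h {Y, Z} {Z, U} {Y, Z, U}] at hL
  obtain ⟨A, B, C, D, _, _, _, _, _, _, _, _, p, hp, hp1, hI⟩ := hh.exists_ent
  have eZ := hI {Z} (fun t => t.2.2.1) fun _ _ => by simp
  have eU := hI {U} (fun t => t.2.2.2) fun _ _ => by simp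
  have eXY := hI {X, Y} (fun t => (t.1, t.2.1)) fun _ _ => by simp [Prod.ext_iff]
  have eXZ := hI {X, Z} (fun t => (t.1, t.2.2.1)) fun _ _ => by simp [Prod.ext_iff]
  have eXU := hI {X, U} (fun t => (t.1, t.2.2.2)) fun _ _ => by simp [Prod.ext_iff]
  have eYZ := hI {Y, Z} (fun t => (t.2.1, t.2.2.1)) fun _ _ => by simp [Prod.ext_iff]
  have eYU := hI {Y, U} (fun t => (t.2.1, t.2.2.2)) fun _ _ => by simp [Prod.ext_iff]
  have eZU := hI {Z, U} (fun t => (t.2.2.2, t.2.2.1)) fun _ _ => by simp [Prod.ext_iff, and_comm]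
  have eXYZ := hI {X, Y, Z} (fun t => (t.1, t.2.1, t.2.2.1)) fun _ _ => by simp [Prod.ext_iff]
  have eXZU := hI {X, Z, U} (fun t => (t.1, t.2.2.2, t.2.2.1)) fun _ _ => by
    simp [Prod.ext_iff]
    tauto
  have eYZU := hI {Y, Z, U} (fun t => (t.2.1, t.2.2.2, t.2.2.1)) fun _ _ => by
    simp [Prod.ext_iff]
    tauto
  have := ingleton_of_xyz_yuz hp (by linarith) (by linarith)
  rw [ingleton]
  linarith

/-- Double Markov gives `W`, a function of `Z` and almost surely of `U`, with `X` independent of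
`(Z, U)` given `W`. Then `I(Z;U|YW) ≥ 0`, `I(X;Y|W) ≥ 0` and `h(XY) ≤ h(WXY)` add up to Ingleton. -/
theorem impliesIngleton_double_two : ImpliesIngleton (double 2) := by
  intro h hh hL
  simp only [double, Matrix.cons_val, Finset.mem_insert,
    Finset.mem_singleton, forall_eq_or_imp, forall_eq] at hL
  rw [delta_ci_eq h {X, U} {Z, U} {X, Z, U}, delta_ci_eq h {X, Z} {Z, U} {X, Z, U}] at hL
  obtain ⟨A, B, C, D, _, _, _, _, _, _, _, _, p, hp, hp1, hI⟩ := hh.exists_ent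
  have eZ := hI {Z} (fun t => t.2.2.1) fun _ _ => by simp
  have eU := hI {U} (fun t => t.2.2.2) fun _ _ => by simp
  have eXY := hI {X, Y} (fun t => (t.1, t.2.1)) fun _ _ => by simp [Prod.ext_iff]
  have eXZ := hI {X, Z} (fun t => (t.1, t.2.2.1)) fun _ _ => by simp [Prod.ext_iff]
  have eXU := hI {X, U} (fun t => (t.1, t.2.2.2)) fun _ _ => by simp [Prod.ext_iff]
  have eYZ := hI {Y, Z} (fun t => (t.2.1, t.2.2.1)) fun _ _ => by simp [Prod.ext_iff]
  have eYU := hI {Y, U} (fun t => (t.2.1, t.2.2.2)) fun _ _ => by simp [Prod.ext_iff]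
  have eZU := hI {Z, U} (fun t => (t.2.2.1, t.2.2.2)) fun _ _ => by simp [Prod.ext_iff]
  have eUZ := hI {Z, U} (fun t => (t.2.2.2, t.2.2.1)) fun _ _ => by simp [Prod.ext_iff, and_comm]
  have eXZU := hI {X, Z, U} (fun t => (t.1, t.2.2.1, t.2.2.2)) fun _ _ => by simp [Prod.ext_iff]
  have eXUZ := hI {X, Z, U} (fun t => (t.1, t.2.2.2, t.2.2.1)) fun _ _ => by
    simp [Prod.ext_iff]
    tauto
  have eYZU := hI {Y, Z, U} (fun t => (t.2.1, t.2.2.1, t.2.2.2)) fun _ _ => by simp [Prod.ext_iff]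
  obtain ⟨W, _, _, w, hw, hW⟩ := exists_doubleMarkov (fun t => t.1) (fun t => t.2.2.1)
    (fun t => t.2.2.2) hp (by linarith) (by linarith)
  have s1 := ent_submodular (fun t : A × B × C × D => t.2.2.1) (fun t => t.2.2.2)
    (fun t => (t.2.1, w t.2.2.1)) hp
  have s2 := ent_submodular (fun t : A × B × C × D => t.1) (fun t => t.2.1)
    (fun t => w t.2.2.1) hp
  have s3 := ent_le_pair (fun t : A × B × C × D => w t.2.2.1) (fun t => (t.1, t.2.1)) hp
  have e1 : ent p (fun t => (t.2.2.1, t.2.2.2, t.2.1, w t.2.2.1)) =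
    ent p (fun t => (t.2.1, t.2.2.1, t.2.2.2)) := ent_congr (by simp; grind)
  have e2 : ent p (fun t => (t.2.2.1, t.2.1, w t.2.2.1)) =
    ent p (fun t => (t.2.1, t.2.2.1)) := ent_congr (by simp; grind)
  have e3 : ent p (fun t => (t.2.2.2, t.2.1, w t.2.2.1)) =
    ent p (fun t => (t.2.1, t.2.2.2)) := ent_congr (by simp at hw ⊢; grind)
  have e4 : ent p (fun t => (t.1, t.2.1, w t.2.2.1)) =
    ent p (fun t => (w t.2.2.1, t.1, t.2.1)) := ent_congr (by simp; grind)
  rw [ingleton]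
  linarith

/-- Here `W` is a function of `X` and almost surely of `U`, with `Z` independent of `(X, U)` given
`W`. The Shannon inequalities used are `I(Z;U|YW) ≥ 0`, `I(X;Y|W) ≥ 0` and `I(W;Y|Z) ≥ 0`. -/
theorem impliesIngleton_double_three : ImpliesIngleton (double 3) := by
  intro h hh hL
  simp only [double, Matrix.cons_val, Finset.mem_insert,
    Finset.mem_singleton, forall_eq_or_imp, forall_eq] at hL
  rw [delta_ci_eq h {X, U} {Z, U} {X, Z, U}, delta_ci_eq h {X, Z} {X, U} {X, Z, U}] at hL
  obtain ⟨A, B, C, D, _, _, _, _, _, _, _, _, p, hp, hp1, hI⟩ := hh.exists_ent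
  have eX := hI {X} (fun t => t.1) fun _ _ => by simp
  have eZ := hI {Z} (fun t => t.2.2.1) fun _ _ => by simp
  have eU := hI {U} (fun t => t.2.2.2) fun _ _ => by simp
  have eXY := hI {X, Y} (fun t => (t.2.1, t.1)) fun _ _ => by simp [Prod.ext_iff, and_comm]
  have eXZ := hI {X, Z} (fun t => (t.2.2.1, t.1)) fun _ _ => by simp [Prod.ext_iff, and_comm]
  have eXU := hI {X, U} (fun t => (t.1, t.2.2.2)) fun _ _ => by simp [Prod.ext_iff]
  have eUX := hI {X, U} (fun t => (t.2.2.2, t.1)) fun _ _ => by simp [Prod.ext_iff, and_comm]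
  have eYZ := hI {Y, Z} (fun t => (t.2.1, t.2.2.1)) fun _ _ => by simp [Prod.ext_iff]
  have eYU := hI {Y, U} (fun t => (t.2.1, t.2.2.2)) fun _ _ => by simp [Prod.ext_iff]
  have eZU := hI {Z, U} (fun t => (t.2.2.1, t.2.2.2)) fun _ _ => by simp [Prod.ext_iff]
  have eZXU := hI {X, Z, U} (fun t => (t.2.2.1, t.1, t.2.2.2)) fun _ _ => by
    simp [Prod.ext_iff]
    tauto
  have eZUX := hI {X, Z, U} (fun t => (t.2.2.1, t.2.2.2, t.1)) fun _ _ => by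
    simp [Prod.ext_iff]
    tauto
  have eYZU := hI {Y, Z, U} (fun t => (t.2.1, t.2.2.1, t.2.2.2)) fun _ _ => by simp [Prod.ext_iff]
  obtain ⟨W, _, _, w, hw, hW⟩ := exists_doubleMarkov (fun t => t.2.2.1) (fun t => t.1)
    (fun t => t.2.2.2) hp (by linarith) (by linarith)
  have s1 := ent_submodular (fun t : A × B × C × D => t.2.2.1) (fun t => t.2.2.2)
    (fun t => (t.2.1, w t.1)) hp
  have s2 := ent_submodular (fun t : A × B × C × D => t.1) (fun t => t.2.1) (fun t => w t.1) hp
  have s3 := ent_submodular (fun t : A × B × C × D => w t.1) (fun t => t.2.1)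
    (fun t => t.2.2.1) hp
  have e1 : ent p (fun t => (t.2.2.1, t.2.2.2, t.2.1, w t.1)) =
    ent p (fun t => (t.2.1, t.2.2.1, t.2.2.2)) := ent_congr (by simp at hw ⊢; grind)
  have e2 : ent p (fun t => (t.2.2.2, t.2.1, w t.1)) =
    ent p (fun t => (t.2.1, t.2.2.2)) := ent_congr (by simp at hw ⊢; grind)
  have e3 : ent p (fun t => (t.2.2.1, t.2.1, w t.1)) =
    ent p (fun t => (w t.1, t.2.1, t.2.2.1)) := ent_congr (by simp; grind)
  have e4 : ent p (fun t => (t.1, t.2.1, w t.1)) = ent p (fun t => (t.2.1, t.1)) :=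
    ent_congr (by simp; grind)
  have e5 : ent p (fun t => (t.1, w t.1)) = ent p (fun t => t.1) :=
    ent_congr (by simp; grind)
  have e6 : ent p (fun t => (w t.1, t.2.2.1)) = ent p (fun t => (t.2.2.1, w t.1)) :=
    ent_congr (by simp; grind)
  rw [ingleton]
  linarith

theorem impliesIngleton_double_four : ImpliesIngleton (double 4) := by
  intro h hh hL
  simp only [double, Matrix.cons_val, Finset.mem_insert,
    Finset.mem_singleton, forall_eq_or_imp, forall_eq] at hL
  rw [delta_ci_eq h {X, U} {Z, U} {X, Z, U}, delta_ci_eq h {Y, U} {Z, U} {Y, Z, U}] at hL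
  obtain ⟨A, B, C, D, _, _, _, _, _, _, _, _, p, hp, hp1, hI⟩ := hh.exists_ent
  have eZ := hI {Z} (fun t => t.2.2.1) fun _ _ => by simp
  have eU := hI {U} (fun t => t.2.2.2) fun _ _ => by simp
  have eXY := hI {X, Y} (fun t => (t.1, t.2.1)) fun _ _ => by simp [Prod.ext_iff]
  have eXZ := hI {X, Z} (fun t => (t.1, t.2.2.1)) fun _ _ => by simp [Prod.ext_iff]
  have eXU := hI {X, U} (fun t => (t.1, t.2.2.2)) fun _ _ => by simp [Prod.ext_iff]
  have eYZ := hI {Y, Z} (fun t => (t.2.1, t.2.2.1)) fun _ _ => by simp [Prod.ext_iff]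
  have eYU := hI {Y, U} (fun t => (t.2.1, t.2.2.2)) fun _ _ => by simp [Prod.ext_iff]
  have eZU := hI {Z, U} (fun t => (t.2.2.1, t.2.2.2)) fun _ _ => by simp [Prod.ext_iff]
  have eXZU := hI {X, Z, U} (fun t => (t.1, t.2.2.1, t.2.2.2)) fun _ _ => by simp [Prod.ext_iff]
  have eYZU := hI {Y, Z, U} (fun t => (t.2.1, t.2.2.1, t.2.2.2)) fun _ _ => by simp [Prod.ext_iff]
  have := ingleton_of_xzu_yzu hp (by linarith) (by linarith)
  rw [ingleton]
  linarith

theorem impliesIngleton_ten (k : Fin 5 ⊕ Fin 5) : ImpliesIngleton (ten k) := by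
  rcases k with a | a
  · exact impliesIngleton_single a
  · fin_cases a
    exacts [impliesIngleton_double_zero, impliesIngleton_double_one, impliesIngleton_double_two,
      impliesIngleton_double_three, impliesIngleton_double_four]

end CondIngleton

namespace CondIngleton

/-! ### Symmetries -/

open Var

/-- The four elements of `symmetries`. -/
def symmetryList : Finset (Equiv.Perm Var) :=
  {1, Equiv.swap X Y, Equiv.swap Z U, Equiv.swap X Y * Equiv.swap Z U}

theorem mem_symmetryList {σ : Equiv.Perm Var} (hσ : σ ∈ symmetries) : σ ∈ symmetryList := by
  have hmul : ∀ s t : Equiv.Perm Var, s ∈ symmetryList → t ∈ symmetryList →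
      s * t ∈ symmetryList := by decide +kernel
  have hinv : ∀ s : Equiv.Perm Var, s ∈ symmetryList → s⁻¹ ∈ symmetryList := by decide +kernel
  induction hσ using Subgroup.closure_induction with
  | mem s hs => rcases hs with rfl | rfl <;> decide +kernel
  | one => decide +kernel
  | mul s t _ _ hs ht => exact hmul s t hs ht
  | inv s _ hs => exact hinv s hs

theorem swap_xy_mem_symmetries : Equiv.swap X Y ∈ symmetries :=
  Subgroup.subset_closure (by simp)

theorem swap_zu_mem_symmetries : Equiv.swap Z U ∈ symmetries :=
  Subgroup.subset_closure (by simp)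

theorem delta_map (σ : Equiv.Perm Var) (c : ElemCI) (h : Finset Var → ℝ) :
    delta c (fun I => h (I.map σ.toEmbedding)) = delta (relabel σ c) h := by
  simp [delta, relabel, Finset.sum_map, Finset.map_union]

theorem ingleton_map {σ : Equiv.Perm Var} (hσ : σ ∈ symmetries) (h : Finset Var → ℝ) :
    ingleton (fun I => h (I.map σ.toEmbedding)) = ingleton h := by
  have hσ := mem_symmetryList hσ
  simp only [symmetryList, Finset.mem_insert, Finset.mem_singleton] at hσ
  rcases hσ with rfl | rfl | rfl | rfl <;>
    simp [ingleton, Equiv.swap_apply_def, Finset.pair_comm Y X, Finset.pair_comm U Z] <;> ring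

theorem relabel_relabel (σ τ : Equiv.Perm Var) (c : ElemCI) :
    relabel σ (relabel τ c) = relabel (σ * τ) c := by
  simp only [relabel, Finset.map_map]
  rfl

theorem relabel_one (c : ElemCI) : relabel 1 c = c := by
  obtain ⟨⟨I, K⟩, h⟩ := c
  exact Subtype.ext (Prod.ext Finset.map_refl Finset.map_refl)

theorem image_relabel_inv (σ : Equiv.Perm Var) (L : Finset ElemCI) :
    (L.image (relabel σ)).image (relabel σ⁻¹) = L := by
  rw [Finset.image_image, show relabel σ⁻¹ ∘ relabel σ = id from
    funext fun c => by simp [relabel_relabel, relabel_one], Finset.image_id]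

theorem ImpliesIngleton.mono {L M : Finset ElemCI} (hL : ImpliesIngleton L) (h : L ⊆ M) :
    ImpliesIngleton M :=
  fun f hf hM => hL f hf fun c hc => hM c (h hc)

theorem ImpliesIngleton.image_relabel {L : Finset ElemCI} (hL : ImpliesIngleton L)
    {σ : Equiv.Perm Var} (hσ : σ ∈ symmetries) : ImpliesIngleton (L.image (relabel σ)) := by
  intro h hh hc
  rw [← ingleton_map hσ]
  refine hL _ (hh.map σ) fun c hcL => ?_
  rw [delta_map]
  exact hc _ (Finset.mem_image_of_mem _ hcL)

/-! ### Distributions with integral weights which violate the Ingleton inequality -/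

/-- The states of four binary variables, coded by four binary digits. -/
def digit : Var → ℕ → Fin 2
  | X, c => Fin.ofNat 2 (c / 8)
  | Y, c => Fin.ofNat 2 (c / 4)
  | Z, c => Fin.ofNat 2 (c / 2)
  | U, c => Fin.ofNat 2 c

/-- The total weight of the states which agree with the state `i` on `I`. -/
def cell {n : ℕ} (code w : Fin n → ℕ) (I : Finset Var) (i : Fin n) : ℕ :=
  ∑ j, if ∀ v ∈ I, digit v (code j) = digit v (code i) then w j else 0

/-- The statement `(i, j | K)` for the distribution with weights `w`. -/
def CellIndep {n : ℕ} (code w : Fin n → ℕ) (c : ElemCI) : Prop :=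
  ∀ s, ∏ v ∈ c.1.1, cell code w ({v} ∪ c.1.2) s =
    cell code w (c.1.1 ∪ c.1.2) s * cell code w c.1.2 s

instance {n : ℕ} (code w : Fin n → ℕ) (c : ElemCI) : Decidable (CellIndep code w c) :=
  inferInstanceAs (Decidable (∀ _, _))

/-- The Ingleton inequality fails for the distribution with weights `w`. -/
def CellViolation {n : ℕ} (code w : Fin n → ℕ) : Prop :=
  ∏ s, (cell code w {X, Y} s * cell code w {Z} s * cell code w {U} s * cell code w {X, Z, U} s *
      cell code w {Y, Z, U} s) ^ w s <
    ∏ s, (cell code w {X, Z} s * cell code w {X, U} s * cell code w {Y, Z} s *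
      cell code w {Y, U} s * cell code w {Z, U} s) ^ w s

instance {n : ℕ} (code w : Fin n → ℕ) : Decidable (CellViolation code w) :=
  inferInstanceAs (Decidable (_ < _))

/-- With total weight `N`, `h(I) = log N - (1/N) ∑ w log (cell I)`. The `log N` terms cancel in both
Ingleton and `Δ`, so exponentiating turns everything into comparisons of natural numbers, which are
decidable. -/
theorem not_impliesIngleton_of_cells {n : ℕ} (code w : Fin n → ℕ) (hw : ∀ s, 0 < w s)
    (hn : 0 < n) {L : Finset ElemCI} (hL : ∀ c ∈ L, CellIndep code w c)
    (hv : CellViolation code w) : ¬ ImpliesIngleton L := by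
  have hN : 0 < ∑ s, w s := Finset.sum_pos (fun s _ => hw s) ⟨⟨0, hn⟩, Finset.mem_univ _⟩
  set N := ∑ s, w s with hNdef
  have hN' : (0 : ℝ) < N := by exact_mod_cast hN
  have hp : ∀ s, (0 : ℝ) ≤ w s / N := fun s => by positivity
  have hp1 : ∑ s, (w s : ℝ) / N = 1 := by
    rw [← Finset.sum_div, ← Nat.cast_sum, div_self hN'.ne']
  have hcell : ∀ I s, 0 < cell code w I s := fun I s =>
    Finset.sum_pos' (fun _ _ => Nat.zero_le _) ⟨s, Finset.mem_univ _, by simpa using hw s⟩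
  have hh := isEntropic_of_pmf hp hp1 (q := fun _ => 2) fun v s => digit v (code s)
  have hent : ∀ I : Finset Var, ent (fun s => (w s : ℝ) / N) (fun s (v : I) => digit v (code s)) =
      -((∑ s, w s * Real.log (cell code w I s)) / N) + Real.log N := fun I => by
    have : ∀ s, marg (fun s => (w s : ℝ) / N) (fun s (v : I) => digit v (code s))
        (fun v : I => digit v (code s)) = cell code w I s / N := fun s => by
      rw [marg, ← Finset.sum_div, Finset.sum_filter, cell]
      push_cast
      congr 1
      refine Finset.sum_congr rfl fun j _ => ?_
      simp [funext_iff]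
    rw [ent_eq]
    simp only [this]
    have : ∀ s, (w s : ℝ) / N * Real.log (cell code w I s / N) =
        w s * Real.log (cell code w I s) / N - w s / N * Real.log N := fun s => by
      rw [Real.log_div (by exact_mod_cast (hcell I s).ne') hN'.ne']
      ring
    rw [Finset.sum_congr rfl fun s _ => this s, Finset.sum_sub_distrib, ← Finset.sum_mul, hp1,
      Finset.sum_div]
    ring
  intro himp
  have := himp _ hh fun c hc => ?_
  · rw [CellViolation, ← Nat.cast_lt (α := ℝ)] at hv
    have hv := Real.log_lt_log (by
      exact_mod_cast Finset.prod_pos fun s _ => pow_pos (by simp [hcell]) _) hv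
    push_cast at hv
    have hc : ∀ I s, (cell code w I s : ℝ) ≠ 0 := fun I s => by exact_mod_cast (hcell I s).ne'
    rw [Real.log_prod (fun s _ => by simp [hc]), Real.log_prod (fun s _ => by simp [hc])] at hv
    simp only [Real.log_pow] at hv
    have hlog : ∀ I₁ I₂ I₃ I₄ I₅ s, Real.log (cell code w I₁ s * cell code w I₂ s *
        cell code w I₃ s * cell code w I₄ s * cell code w I₅ s) =
        Real.log (cell code w I₁ s) + Real.log (cell code w I₂ s) + Real.log (cell code w I₃ s) +
          Real.log (cell code w I₄ s) + Real.log (cell code w I₅ s) := fun _ _ _ _ _ _ => by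
      rw [Real.log_mul (by simp [hc]) (hc _ _), Real.log_mul (by simp [hc]) (hc _ _),
        Real.log_mul (by simp [hc]) (hc _ _), Real.log_mul (hc _ _) (hc _ _)]
    simp only [hlog, mul_add, Finset.sum_add_distrib] at hv
    have hv := div_lt_div_of_pos_right hv hN'
    simp only [ingleton, hent] at this
    simp only [add_div] at hv
    linarith
  · rw [delta]
    simp only [hent, Finset.sum_add_distrib, Finset.sum_const, c.2.1, Finset.sum_neg_distrib]
    have : ∀ s, ∑ v ∈ c.1.1, Real.log (cell code w ({v} ∪ c.1.2) s) =
        Real.log (cell code w (c.1.1 ∪ c.1.2) s) + Real.log (cell code w c.1.2 s) := fun s => by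
      rw [← Real.log_prod fun v _ => by exact_mod_cast (hcell _ s).ne',
        ← Real.log_mul (by exact_mod_cast (hcell _ s).ne') (by exact_mod_cast (hcell _ s).ne')]
      exact_mod_cast congrArg (fun m : ℕ => Real.log m) (hL c hc s)
    rw [← Finset.sum_div, Finset.sum_comm]
    simp only [← Finset.mul_sum, this, mul_add, Finset.sum_add_distrib]
    simp only [nsmul_eq_mul]
    push_cast
    ring

/-- Sets of assumptions which do not imply the Ingleton inequality. -/
def compatible : Fin 5 → Finset ElemCI :=
  ![{ci X Y ∅, ci X Z {U}, ci Y U {Z}, ci Z U {X, Y}},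
    {ci X Y ∅, ci X Z {U}, ci Z U {Y}, ci Z U {X, Y}},
    {ci X Y {Z}, ci X Z {U}, ci Z U {Y}, ci Z U {X, Y}},
    {ci X Y ∅, ci Z U {X}, ci Z U {Y}, ci Z U {X, Y}},
    {ci X Y {Z}, ci X Y {U}, ci Z U {X}, ci Z U {Y}, ci Z U {X, Y}}]

theorem not_impliesIngleton_compatible (m : Fin 5) : ¬ ImpliesIngleton (compatible m) := by
  fin_cases m
  · exact not_impliesIngleton_of_cells
      ![0b0001, 0b0100, 0b0101, 0b0110, 0b0111, 0b1000, 0b1001, 0b1010, 0b1011, 0b1100, 0b1110]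
      ![252, 14, 42, 7, 21, 126, 42, 9, 3, 4, 56] (by decide +kernel) (by decide)
      (by decide +kernel) (by decide +kernel)
  · exact not_impliesIngleton_of_cells ![0b0011, 0b0101, 0b1010, 0b1101, 0b1111] ![1, 1, 2, 1, 1]
      (by decide +kernel) (by decide) (by decide +kernel) (by decide +kernel)
  · exact not_impliesIngleton_of_cells ![0b0011, 0b0101, 0b0111, 0b1010, 0b1101, 0b1111]
      ![1, 2, 1, 1, 1, 1] (by decide +kernel) (by decide) (by decide +kernel) (by decide +kernel)
  · exact not_impliesIngleton_of_cells ![0b0011, 0b0110, 0b1010, 0b1100] ![1, 1, 1, 1]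
      (by decide +kernel) (by decide) (by decide +kernel) (by decide +kernel)
  · exact not_impliesIngleton_of_cells ![0b0011, 0b0110, 0b0111, 0b1001, 0b1011, 0b1111]
      ![1, 1, 1, 1, 1, 2] (by decide +kernel) (by decide) (by decide +kernel) (by decide +kernel)

end CondIngleton

namespace CondIngleton

/-! ### The classification -/

open Var

/-- The statements which do not imply the Ingleton inequality by themselves. -/
def nonSingle : Finset ElemCI :=
  {ci X Y ∅, ci X Y {Z}, ci X Y {U}, ci X Z {U}, ci X U {Z}, ci Y Z {U}, ci Y U {Z},
    ci Z U {X}, ci Z U {Y}, ci Z U {X, Y}}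

theorem mem_nonSingle_or (c : ElemCI) :
    c ∈ nonSingle ∨ ∃ a : Fin 5, ∃ σ ∈ symmetryList, (single a).image (relabel σ) = {c} := by
  revert c
  decide +kernel

theorem mem_symmetries_of_mem_symmetryList {σ : Equiv.Perm Var} (hσ : σ ∈ symmetryList) :
    σ ∈ symmetries := by
  simp only [symmetryList, Finset.mem_insert, Finset.mem_singleton] at hσ
  rcases hσ with rfl | rfl | rfl | rfl
  · exact one_mem _
  · exact swap_xy_mem_symmetries
  · exact swap_zu_mem_symmetries
  · exact mul_mem swap_xy_mem_symmetries swap_zu_mem_symmetries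

theorem subset_compatible {L : Finset ElemCI}
    (hL : ∀ k, ∀ σ ∈ symmetryList, ¬ (ten k).image (relabel σ) ⊆ L) :
    ∃ m, ∃ σ ∈ symmetryList, L ⊆ (compatible m).image (relabel σ) := by
  -- What remains is a graph problem: `L` is an independent set in the graph on `nonSingle` whose 14
  -- edges are the images of the doubles.
  have hsub : L ⊆ nonSingle := fun c hc => (mem_nonSingle_or c).resolve_right
    fun ⟨a, σ, hσ, h⟩ => hL (.inl a) σ hσ (by
      rw [ten, Sum.elim_inl, h]; exact Finset.singleton_subset_iff.2 hc)
  have hpair : ∀ c c', (∃ a : Fin 5, ∃ σ ∈ symmetryList,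
      (double a).image (relabel σ) = {c, c'}) → ¬ (c ∈ L ∧ c' ∈ L) :=
    fun c c' ⟨a, σ, hσ, h⟩ ⟨hc, hc'⟩ => hL (.inr a) σ hσ (by
      rw [ten, Sum.elim_inr, h]
      exact Finset.insert_subset hc (Finset.singleton_subset_iff.2 hc'))
  have h1 := hpair (ci X Y ∅) (ci X Y {Z}) (by decide +kernel)
  have h2 := hpair (ci X Y ∅) (ci X Y {U}) (by decide +kernel)
  have h3 := hpair (ci X Y {Z}) (ci Y U {Z}) (by decide +kernel)
  have h4 := hpair (ci X Y {Z}) (ci X U {Z}) (by decide +kernel)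
  have h5 := hpair (ci X Y {U}) (ci Y Z {U}) (by decide +kernel)
  have h6 := hpair (ci X Y {U}) (ci X Z {U}) (by decide +kernel)
  have h7 := hpair (ci X Z {U}) (ci X U {Z}) (by decide +kernel)
  have h8 := hpair (ci Y Z {U}) (ci Y U {Z}) (by decide +kernel)
  have h9 := hpair (ci X Z {U}) (ci Z U {X}) (by decide +kernel)
  have h10 := hpair (ci Y Z {U}) (ci Z U {Y}) (by decide +kernel)
  have h11 := hpair (ci X U {Z}) (ci Z U {X}) (by decide +kernel)
  have h12 := hpair (ci Y U {Z}) (ci Z U {Y}) (by decide +kernel)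
  have h13 := hpair (ci X Z {U}) (ci Y Z {U}) (by decide +kernel)
  have h14 := hpair (ci X U {Z}) (ci Y U {Z}) (by decide +kernel)
  have hM : ∀ E : Finset ElemCI, Disjoint L E → (∃ m, ∃ σ ∈ symmetryList,
      nonSingle \ E ⊆ (compatible m).image (relabel σ)) →
      ∃ m, ∃ σ ∈ symmetryList, L ⊆ (compatible m).image (relabel σ) :=
    fun E hE ⟨m, σ, hσ, h⟩ => ⟨m, σ, hσ, (Finset.subset_sdiff.2 ⟨hsub, hE⟩).trans h⟩
  simp only [Finset.disjoint_right] at hM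
  -- The twelve sets are the complements of the maximal independent sets. Under the symmetries these
  -- fall into five classes, of sizes 2, 4, 4, 1, 1, represented by `compatible`.
  have m1 := hM {ci X Y {Z}, ci X Y {U}, ci X U {Z}, ci Y Z {U}, ci Z U {X}, ci Z U {Y}}
  have m2 := hM {ci X Y {Z}, ci X Y {U}, ci X Z {U}, ci Y U {Z}, ci Z U {X}, ci Z U {Y}}
  have m3 := hM {ci X Y {Z}, ci X Y {U}, ci X U {Z}, ci Y Z {U}, ci Y U {Z}, ci Z U {X}}
  have m4 := hM {ci X Y {Z}, ci X Y {U}, ci X U {Z}, ci X Z {U}, ci Y U {Z}, ci Z U {Y}}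
  have m5 := hM {ci X Y {Z}, ci X Y {U}, ci X Z {U}, ci Y Z {U}, ci Y U {Z}, ci Z U {X}}
  have m6 := hM {ci X Y {Z}, ci X Y {U}, ci X Z {U}, ci X U {Z}, ci Y Z {U}, ci Z U {Y}}
  have m7 := hM {ci X Y ∅, ci X Y {U}, ci X U {Z}, ci Y Z {U}, ci Y U {Z}, ci Z U {X}}
  have m8 := hM {ci X Y ∅, ci X Y {U}, ci X U {Z}, ci X Z {U}, ci Y U {Z}, ci Z U {Y}}
  have m9 := hM {ci X Y ∅, ci X Y {Z}, ci X Z {U}, ci Y Z {U}, ci Y U {Z}, ci Z U {X}}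
  have m10 := hM {ci X Y ∅, ci X Y {Z}, ci X Z {U}, ci X U {Z}, ci Y Z {U}, ci Z U {Y}}
  have m11 := hM {ci X Y {Z}, ci X Y {U}, ci X Z {U}, ci X U {Z}, ci Y Z {U}, ci Y U {Z}}
  have m12 := hM {ci X Y ∅, ci X Z {U}, ci X U {Z}, ci Y Z {U}, ci Y U {Z}}
  simp only [Finset.mem_insert, Finset.mem_singleton, forall_eq_or_imp, forall_eq]
    at m1 m2 m3 m4 m5 m6 m7 m8 m9 m10 m11 m12
  replace m1 := fun h => m1 h (by decide +kernel)
  replace m2 := fun h => m2 h (by decide +kernel)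
  replace m3 := fun h => m3 h (by decide +kernel)
  replace m4 := fun h => m4 h (by decide +kernel)
  replace m5 := fun h => m5 h (by decide +kernel)
  replace m6 := fun h => m6 h (by decide +kernel)
  replace m7 := fun h => m7 h (by decide +kernel)
  replace m8 := fun h => m8 h (by decide +kernel)
  replace m9 := fun h => m9 h (by decide +kernel)
  replace m10 := fun h => m10 h (by decide +kernel)
  replace m11 := fun h => m11 h (by decide +kernel)
  replace m12 := fun h => m12 h (by decide +kernel)
  clear hM hpair hsub hL
  generalize (∃ m, ∃ σ ∈ symmetryList, L ⊆ (compatible m).image (relabel σ)) = goal at *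
  generalize (ci X Y ∅ ∈ L) = a at *
  generalize (ci X Y {Z} ∈ L) = b at *
  generalize (ci X Y {U} ∈ L) = c at *
  generalize (ci X Z {U} ∈ L) = d at *
  generalize (ci X U {Z} ∈ L) = e at *
  generalize (ci Y Z {U} ∈ L) = f at *
  generalize (ci Y U {Z} ∈ L) = g at *
  generalize (ci Z U {X} ∈ L) = p at *
  generalize (ci Z U {Y} ∈ L) = q at *
  by_contra hgoal
  -- The statements `d, e, g, f` form a 4-cycle. Which of them belong to `L`, together with `a`,
  -- decides which maximal set contains `L`.
  by_cases d <;> by_cases f <;> by_cases e <;> by_cases g <;> by_cases a <;> simp_all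

theorem ImpliesIngleton.exists_ten {L : Finset ElemCI} (hL : ImpliesIngleton L) :
    ∃ k, ∃ σ ∈ symmetryList, (ten k).image (relabel σ) ⊆ L := by
  by_contra! h
  obtain ⟨m, σ, hσ, hm⟩ := subset_compatible h
  have := (hL.mono hm).image_relabel (inv_mem (mem_symmetries_of_mem_symmetryList hσ))
  rw [image_relabel_inv] at this
  exact not_impliesIngleton_compatible m this

/-- Yields minimality of every image (through the reverse inclusion) and pairwise inequivalence
(through `k = k'`). -/
theorem ten_antichain : ∀ k, ∀ σ ∈ symmetryList, ∀ k', ∀ τ ∈ symmetryList,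
    (ten k).image (relabel σ) ⊆ (ten k').image (relabel τ) →
      k = k' ∧ (ten k').image (relabel τ) ⊆ (ten k).image (relabel σ) := by
  decide +kernel

theorem minimal_impliesIngleton_iff (L : Finset ElemCI) :
    Minimal ImpliesIngleton L ↔ ∃ k : Fin 5 ⊕ Fin 5, SameUpToSymmetry (ten k) L := by
  constructor
  · intro hL
    obtain ⟨k, σ, hσ, hk⟩ := hL.prop.exists_ten
    have hσ := mem_symmetries_of_mem_symmetryList hσ
    exact ⟨k, σ, hσ, hL.eq_of_le ((impliesIngleton_ten k).image_relabel hσ) hk⟩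
  · rintro ⟨k, σ, hσ, rfl⟩
    refine ⟨(impliesIngleton_ten k).image_relabel hσ, fun M hM hle => ?_⟩
    obtain ⟨k', τ, hτ, hk'⟩ := ImpliesIngleton.exists_ten hM
    exact (ten_antichain k' τ hτ k σ (mem_symmetryList hσ) (hk'.trans hle)).2.trans hk'

theorem ten_inequivalent {k k' : Fin 5 ⊕ Fin 5} (h : SameUpToSymmetry (ten k) (ten k')) :
    k = k' := by
  obtain ⟨σ, hσ, h⟩ := h
  refine (ten_antichain k σ (mem_symmetryList hσ) k' 1 (mem_symmetryList (one_mem _)) ?_).1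
  rw [h, show relabel 1 = id from funext relabel_one, Finset.image_id]

end CondIngleton

namespace CondIngleton

/-! ### Entropy vectors of binary distributions with few states -/

open Var Real

/-- The entropy vector of the distribution with masses `w s` at the states coded by `code s`. -/
noncomputable def binaryEntropies {n : ℕ} (w : Fin n → ℝ) (code : Fin n → ℕ) (I : Finset Var) : ℝ :=
  ent w fun s (v : I) => digit v (code s)

theorem isEntropic_binaryEntropies {n : ℕ} {w : Fin n → ℝ} (code : Fin n → ℕ)
    (hw : ∀ s, 0 ≤ w s) (hw1 : ∑ s, w s = 1) : IsEntropic (binaryEntropies w code) :=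
  isEntropic_of_pmf hw hw1 (q := fun _ => 2) fun v s => digit v (code s)

/-- Only the partition of the atoms by their `I`-digits matters; `label` names its blocks, so the
hypothesis can be settled by `decide` for concrete codes. -/
theorem binaryEntropies_eq {n m : ℕ} {w : Fin n → ℝ} {code : Fin n → ℕ} {I : Finset Var}
    (label : Fin n → Fin m)
    (h : ∀ i j, (∀ v ∈ I, digit v (code i) = digit v (code j)) ↔ label i = label j) :
    binaryEntropies w code I = ∑ k, negMulLog (∑ i, if label i = k then w i else 0) := by
  rw [binaryEntropies, ent_congr (g := label) fun s s' _ _ => by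
    rw [← h, funext_iff]
    exact ⟨fun H v hv => H ⟨v, hv⟩, fun H v => H v v.2⟩]
  simp only [ent, marg, Finset.sum_filter]

noncomputable section

/-- The entropy vector of two independent binary variables `X`, `Y` with probability `e` of `1`, and
`Z = X Y`, `U = (1 - X) (1 - Y)`. -/
def curveA (e : ℝ) : Finset Var → ℝ :=
  binaryEntropies ![(1 - e) ^ 2, e * (1 - e), e * (1 - e), e ^ 2]
    ![0b0001, 0b0100, 0b1000, 0b1110]

theorem curveA_z (e : ℝ) : curveA e {Z} =
    negMulLog ((1 - e) ^ 2 + e * (1 - e) + e * (1 - e)) + negMulLog (e ^ 2) :=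
  (binaryEntropies_eq (![0, 0, 0, 1] : Fin 4 → Fin 2) (by decide)).trans
    (by simp [Fin.sum_univ_succ, add_assoc])

theorem curveA_u (e : ℝ) : curveA e {U} =
    negMulLog ((1 - e) ^ 2) + negMulLog (e * (1 - e) + e * (1 - e) + e ^ 2) :=
  (binaryEntropies_eq (![0, 1, 1, 1] : Fin 4 → Fin 2) (by decide)).trans
    (by simp [Fin.sum_univ_succ, add_assoc])

theorem curveA_xy (e : ℝ) : curveA e {X, Y} =
    negMulLog ((1 - e) ^ 2) + negMulLog (e * (1 - e)) + negMulLog (e * (1 - e)) +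
      negMulLog (e ^ 2) :=
  (binaryEntropies_eq (![0, 1, 2, 3] : Fin 4 → Fin 4) (by decide)).trans
    (by simp [Fin.sum_univ_succ, add_assoc])

theorem curveA_xz (e : ℝ) : curveA e {X, Z} =
    negMulLog ((1 - e) ^ 2 + e * (1 - e)) + negMulLog (e * (1 - e)) + negMulLog (e ^ 2) :=
  (binaryEntropies_eq (![0, 0, 1, 2] : Fin 4 → Fin 3) (by decide)).trans
    (by simp [Fin.sum_univ_succ, add_assoc])

theorem curveA_xu (e : ℝ) : curveA e {X, U} =
    negMulLog ((1 - e) ^ 2) + negMulLog (e * (1 - e)) + negMulLog (e * (1 - e) + e ^ 2) :=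
  (binaryEntropies_eq (![0, 1, 2, 2] : Fin 4 → Fin 3) (by decide)).trans
    (by simp [Fin.sum_univ_succ, add_assoc])

theorem curveA_yz (e : ℝ) : curveA e {Y, Z} =
    negMulLog ((1 - e) ^ 2 + e * (1 - e)) + negMulLog (e * (1 - e)) + negMulLog (e ^ 2) :=
  (binaryEntropies_eq (![0, 1, 0, 2] : Fin 4 → Fin 3) (by decide)).trans
    (by simp [Fin.sum_univ_succ, add_assoc])

theorem curveA_yu (e : ℝ) : curveA e {Y, U} =
    negMulLog ((1 - e) ^ 2) + negMulLog (e * (1 - e) + e ^ 2) + negMulLog (e * (1 - e)) :=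
  (binaryEntropies_eq (![0, 1, 2, 1] : Fin 4 → Fin 3) (by decide)).trans
    (by simp [Fin.sum_univ_succ, add_assoc])

theorem curveA_zu (e : ℝ) : curveA e {Z, U} =
    negMulLog ((1 - e) ^ 2) + negMulLog (e * (1 - e) + e * (1 - e)) + negMulLog (e ^ 2) :=
  (binaryEntropies_eq (![0, 1, 1, 2] : Fin 4 → Fin 3) (by decide)).trans
    (by simp [Fin.sum_univ_succ, add_assoc])

theorem curveA_xzu (e : ℝ) : curveA e {X, Z, U} =
    negMulLog ((1 - e) ^ 2) + negMulLog (e * (1 - e)) + negMulLog (e * (1 - e)) +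
      negMulLog (e ^ 2) :=
  (binaryEntropies_eq (![0, 1, 2, 3] : Fin 4 → Fin 4) (by decide)).trans
    (by simp [Fin.sum_univ_succ, add_assoc])

theorem curveA_yzu (e : ℝ) : curveA e {Y, Z, U} =
    negMulLog ((1 - e) ^ 2) + negMulLog (e * (1 - e)) + negMulLog (e * (1 - e)) +
      negMulLog (e ^ 2) :=
  (binaryEntropies_eq (![0, 1, 2, 3] : Fin 4 → Fin 4) (by decide)).trans
    (by simp [Fin.sum_univ_succ, add_assoc])

theorem curveA_x (e : ℝ) : curveA e {X} =
    negMulLog ((1 - e) ^ 2 + e * (1 - e)) + negMulLog (e * (1 - e) + e ^ 2) :=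
  (binaryEntropies_eq (![0, 0, 1, 1] : Fin 4 → Fin 2) (by decide)).trans
    (by simp [Fin.sum_univ_succ])

theorem curveA_y (e : ℝ) : curveA e {Y} =
    negMulLog ((1 - e) ^ 2 + e * (1 - e)) + negMulLog (e * (1 - e) + e ^ 2) :=
  (binaryEntropies_eq (![0, 1, 0, 1] : Fin 4 → Fin 2) (by decide)).trans
    (by simp [Fin.sum_univ_succ])

theorem curveA_xyz (e : ℝ) : curveA e {X, Y, Z} =
    negMulLog ((1 - e) ^ 2) + negMulLog (e * (1 - e)) + negMulLog (e * (1 - e)) +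
      negMulLog (e ^ 2) :=
  (binaryEntropies_eq (![0, 1, 2, 3] : Fin 4 → Fin 4) (by decide)).trans
    (by simp [Fin.sum_univ_succ, add_assoc])

/-- The entropy vector of the distribution with one mass `e` and three masses `q`. -/
def curveB (e q : ℝ) : Finset Var → ℝ :=
  binaryEntropies ![e, q, q, q]
    ![0b0010, 0b0111, 0b1000, 0b1110]

theorem curveB_z (e q : ℝ) : curveB e q {Z} =
    negMulLog (e + q + q) + negMulLog (q) :=
  (binaryEntropies_eq (![0, 0, 1, 0] : Fin 4 → Fin 2) (by decide)).trans
    (by simp [Fin.sum_univ_succ, add_assoc])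

theorem curveB_u (e q : ℝ) : curveB e q {U} =
    negMulLog (e + q + q) + negMulLog (q) :=
  (binaryEntropies_eq (![0, 1, 0, 0] : Fin 4 → Fin 2) (by decide)).trans
    (by simp [Fin.sum_univ_succ, add_assoc])

theorem curveB_xy (e q : ℝ) : curveB e q {X, Y} =
    negMulLog e + negMulLog (q) + negMulLog (q) + negMulLog (q) :=
  (binaryEntropies_eq (![0, 1, 2, 3] : Fin 4 → Fin 4) (by decide)).trans
    (by simp [Fin.sum_univ_succ, add_assoc])

theorem curveB_xz (e q : ℝ) : curveB e q {X, Z} =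
    negMulLog (e + q) + negMulLog (q) + negMulLog (q) :=
  (binaryEntropies_eq (![0, 0, 1, 2] : Fin 4 → Fin 3) (by decide)).trans
    (by simp [Fin.sum_univ_succ, add_assoc])

theorem curveB_xu (e q : ℝ) : curveB e q {X, U} =
    negMulLog e + negMulLog (q) + negMulLog (q + q) :=
  (binaryEntropies_eq (![0, 1, 2, 2] : Fin 4 → Fin 3) (by decide)).trans
    (by simp [Fin.sum_univ_succ, add_assoc])

theorem curveB_yz (e q : ℝ) : curveB e q {Y, Z} =
    negMulLog e + negMulLog (q + q) + negMulLog (q) :=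
  (binaryEntropies_eq (![0, 1, 2, 1] : Fin 4 → Fin 3) (by decide)).trans
    (by simp [Fin.sum_univ_succ, add_assoc])

theorem curveB_yu (e q : ℝ) : curveB e q {Y, U} =
    negMulLog (e + q) + negMulLog (q) + negMulLog (q) :=
  (binaryEntropies_eq (![0, 1, 0, 2] : Fin 4 → Fin 3) (by decide)).trans
    (by simp [Fin.sum_univ_succ, add_assoc])

theorem curveB_zu (e q : ℝ) : curveB e q {Z, U} =
    negMulLog (e + q) + negMulLog (q) + negMulLog (q) :=
  (binaryEntropies_eq (![0, 1, 2, 0] : Fin 4 → Fin 3) (by decide)).trans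
    (by simp [Fin.sum_univ_succ, add_assoc])

theorem curveB_xzu (e q : ℝ) : curveB e q {X, Z, U} =
    negMulLog e + negMulLog (q) + negMulLog (q) + negMulLog (q) :=
  (binaryEntropies_eq (![0, 1, 2, 3] : Fin 4 → Fin 4) (by decide)).trans
    (by simp [Fin.sum_univ_succ, add_assoc])

theorem curveB_yzu (e q : ℝ) : curveB e q {Y, Z, U} =
    negMulLog e + negMulLog (q) + negMulLog (q) + negMulLog (q) :=
  (binaryEntropies_eq (![0, 1, 2, 3] : Fin 4 → Fin 4) (by decide)).trans
    (by simp [Fin.sum_univ_succ, add_assoc])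

theorem curveB_x (e q : ℝ) : curveB e q {X} =
    negMulLog (e + q) + negMulLog (q + q) :=
  (binaryEntropies_eq (![0, 0, 1, 1] : Fin 4 → Fin 2) (by decide)).trans
    (by simp [Fin.sum_univ_succ])

theorem curveB_xyz (e q : ℝ) : curveB e q {X, Y, Z} =
    negMulLog e + negMulLog (q) + negMulLog (q) + negMulLog (q) :=
  (binaryEntropies_eq (![0, 1, 2, 3] : Fin 4 → Fin 4) (by decide)).trans
    (by simp [Fin.sum_univ_succ, add_assoc])

/-- The entropy vector of a distribution with two masses each of `a`, `c`, `b`. -/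
def curveC (a b c : ℝ) : Finset Var → ℝ :=
  binaryEntropies ![a, a, c, c, b, b]
    ![0b0001, 0b1110, 0b0110, 0b1001, 0b0100, 0b1000]

theorem curveC_z (a b c : ℝ) : curveC a b c {Z} =
    negMulLog (a + c + b + b) + negMulLog (a + c) :=
  (binaryEntropies_eq (![0, 1, 1, 0, 0, 0] : Fin 6 → Fin 2) (by decide)).trans
    (by simp [Fin.sum_univ_succ, add_assoc])

theorem curveC_u (a b c : ℝ) : curveC a b c {U} =
    negMulLog (a + c) + negMulLog (a + c + b + b) :=
  (binaryEntropies_eq (![0, 1, 1, 0, 1, 1] : Fin 6 → Fin 2) (by decide)).trans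
    (by simp [Fin.sum_univ_succ, add_assoc])

theorem curveC_xy (a b c : ℝ) : curveC a b c {X, Y} =
    negMulLog (a) + negMulLog (a) + negMulLog (c + b) + negMulLog (c + b) :=
  (binaryEntropies_eq (![0, 1, 2, 3, 2, 3] : Fin 6 → Fin 4) (by decide)).trans
    (by simp [Fin.sum_univ_succ, add_assoc])

theorem curveC_xz (a b c : ℝ) : curveC a b c {X, Z} =
    negMulLog (a + b) + negMulLog (a) + negMulLog (c) + negMulLog (c + b) :=
  (binaryEntropies_eq (![0, 1, 2, 3, 0, 3] : Fin 6 → Fin 4) (by decide)).trans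
    (by simp [Fin.sum_univ_succ, add_assoc])

theorem curveC_xu (a b c : ℝ) : curveC a b c {X, U} =
    negMulLog (a) + negMulLog (a + b) + negMulLog (c + b) + negMulLog (c) :=
  (binaryEntropies_eq (![0, 1, 2, 3, 2, 1] : Fin 6 → Fin 4) (by decide)).trans
    (by simp [Fin.sum_univ_succ, add_assoc])

theorem curveC_yz (a b c : ℝ) : curveC a b c {Y, Z} =
    negMulLog (a + c + b) + negMulLog (a + c) + negMulLog (b) :=
  (binaryEntropies_eq (![0, 1, 1, 0, 2, 0] : Fin 6 → Fin 3) (by decide)).trans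
    (by simp [Fin.sum_univ_succ, add_assoc])

theorem curveC_yu (a b c : ℝ) : curveC a b c {Y, U} =
    negMulLog (a + c) + negMulLog (a + c + b) + negMulLog (b) :=
  (binaryEntropies_eq (![0, 1, 1, 0, 1, 2] : Fin 6 → Fin 3) (by decide)).trans
    (by simp [Fin.sum_univ_succ, add_assoc])

theorem curveC_zu (a b c : ℝ) : curveC a b c {Z, U} =
    negMulLog (a + c) + negMulLog (a + c) + negMulLog (b + b) :=
  (binaryEntropies_eq (![0, 1, 1, 0, 2, 2] : Fin 6 → Fin 3) (by decide)).trans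
    (by simp [Fin.sum_univ_succ, add_assoc])

theorem curveC_xzu (a b c : ℝ) : curveC a b c {X, Z, U} =
    negMulLog (a) + negMulLog (a) + negMulLog (c) + negMulLog (c) + negMulLog (b) + negMulLog (b) :=
  (binaryEntropies_eq (![0, 1, 2, 3, 4, 5] : Fin 6 → Fin 6) (by decide)).trans
    (by simp [Fin.sum_univ_succ, add_assoc])

theorem curveC_yzu (a b c : ℝ) : curveC a b c {Y, Z, U} =
    negMulLog (a + c) + negMulLog (a + c) + negMulLog (b) + negMulLog (b) :=
  (binaryEntropies_eq (![0, 1, 1, 0, 2, 3] : Fin 6 → Fin 4) (by decide)).trans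
    (by simp [Fin.sum_univ_succ, add_assoc])

/-- The entropy vector of the distribution `epsCurve e`. -/
def curveD (e : ℝ) : Finset Var → ℝ :=
  binaryEntropies ![1 / 5 - e, 1 / 5, 1 / 5, 1 / 5, 1 / 5, e]
    ![0b0010, 0b0110, 0b1010, 0b1101, 0b1111, 0b1100]

theorem curveD_z (e : ℝ) : curveD e {Z} =
    negMulLog (1 / 5 - e + 1 / 5 + 1 / 5 + 1 / 5) + negMulLog (1 / 5 + e) :=
  (binaryEntropies_eq (![0, 0, 0, 1, 0, 1] : Fin 6 → Fin 2) (by decide)).trans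
    (by simp [Fin.sum_univ_succ, add_assoc])

theorem curveD_u (e : ℝ) : curveD e {U} =
    negMulLog (1 / 5 - e + 1 / 5 + 1 / 5 + e) + negMulLog (1 / 5 + 1 / 5) :=
  (binaryEntropies_eq (![0, 0, 0, 1, 1, 0] : Fin 6 → Fin 2) (by decide)).trans
    (by simp [Fin.sum_univ_succ, add_assoc])

theorem curveD_xy (e : ℝ) : curveD e {X, Y} =
    negMulLog (1 / 5 - e) + negMulLog (1 / 5) + negMulLog (1 / 5) + negMulLog (1 / 5 + 1 / 5 + e) :=
  (binaryEntropies_eq (![0, 1, 2, 3, 3, 3] : Fin 6 → Fin 4) (by decide)).trans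
    (by simp [Fin.sum_univ_succ, add_assoc])

theorem curveD_xz (e : ℝ) : curveD e {X, Z} =
    negMulLog (1 / 5 - e + 1 / 5) + negMulLog (1 / 5 + 1 / 5) + negMulLog (1 / 5 + e) :=
  (binaryEntropies_eq (![0, 0, 1, 2, 1, 2] : Fin 6 → Fin 3) (by decide)).trans
    (by simp [Fin.sum_univ_succ, add_assoc])

theorem curveD_xu (e : ℝ) : curveD e {X, U} =
    negMulLog (1 / 5 - e + 1 / 5) + negMulLog (1 / 5 + e) + negMulLog (1 / 5 + 1 / 5) :=
  (binaryEntropies_eq (![0, 0, 1, 2, 2, 1] : Fin 6 → Fin 3) (by decide)).trans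
    (by simp [Fin.sum_univ_succ, add_assoc])

theorem curveD_yz (e : ℝ) : curveD e {Y, Z} =
    negMulLog (1 / 5 - e + 1 / 5) + negMulLog (1 / 5 + 1 / 5) + negMulLog (1 / 5 + e) :=
  (binaryEntropies_eq (![0, 1, 0, 2, 1, 2] : Fin 6 → Fin 3) (by decide)).trans
    (by simp [Fin.sum_univ_succ, add_assoc])

theorem curveD_yu (e : ℝ) : curveD e {Y, U} =
    negMulLog (1 / 5 - e + 1 / 5) + negMulLog (1 / 5 + e) + negMulLog (1 / 5 + 1 / 5) :=
  (binaryEntropies_eq (![0, 1, 0, 2, 2, 1] : Fin 6 → Fin 3) (by decide)).trans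
    (by simp [Fin.sum_univ_succ, add_assoc])

theorem curveD_zu (e : ℝ) : curveD e {Z, U} =
    negMulLog (1 / 5 - e + 1 / 5 + 1 / 5) + negMulLog (1 / 5) + negMulLog (1 / 5) + negMulLog e :=
  (binaryEntropies_eq (![0, 0, 0, 1, 2, 3] : Fin 6 → Fin 4) (by decide)).trans
    (by simp [Fin.sum_univ_succ, add_assoc])

theorem curveD_xzu (e : ℝ) : curveD e {X, Z, U} =
    negMulLog (1 / 5 - e + 1 / 5) + negMulLog (1 / 5) + negMulLog (1 / 5) + negMulLog (1 / 5) +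
      negMulLog e :=
  (binaryEntropies_eq (![0, 0, 1, 2, 3, 4] : Fin 6 → Fin 5) (by decide)).trans
    (by simp [Fin.sum_univ_succ, add_assoc])

theorem curveD_yzu (e : ℝ) : curveD e {Y, Z, U} =
    negMulLog (1 / 5 - e + 1 / 5) + negMulLog (1 / 5) + negMulLog (1 / 5) + negMulLog (1 / 5) +
      negMulLog e :=
  (binaryEntropies_eq (![0, 1, 0, 2, 3, 4] : Fin 6 → Fin 5) (by decide)).trans
    (by simp [Fin.sum_univ_succ, add_assoc])

end

end CondIngleton

namespace CondIngleton

/-! ### Essentially conditional inequalities -/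

open Var Real

/-- Concavity: the graph of `η` lies below its tangent at `y`. -/
theorem negMulLog_sub_le {x y : ℝ} (hx : 0 ≤ x) (hy : 0 < y) :
    negMulLog x - negMulLog y ≤ (-log y - 1) * (x - y) := by
  have := gibbs_term hx hy.le fun h => (hy.ne' h).elim
  simp only [negMulLog]
  linarith

theorem essentiallyConditional_pair {c c' : ElemCI} (hne : c ≠ c')
    (H : ∀ l m : ℝ, 0 ≤ l → 0 ≤ m → ∃ h, IsEntropic h ∧
      ingleton h + (l * delta c h + m * delta c' h) < 0) :
    EssentiallyConditional {c, c'} := by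
  rintro ⟨lam, hlam, hpos⟩
  obtain ⟨h, hh, hlt⟩ := H (lam c) (lam c') (hlam c (by simp)) (hlam c' (by simp))
  have := hpos h hh
  rw [Finset.sum_pair hne] at this
  exact hlt.not_ge this

theorem isEntropic_curveA {e : ℝ} (h0 : 0 ≤ e) (h1 : e ≤ 1) : IsEntropic (curveA e) := by
  have : 0 ≤ e * (1 - e) := mul_nonneg h0 (by linarith)
  refine isEntropic_binaryEntropies _ (fun s => ?_) ?_
  · fin_cases s <;> simp [this] <;> positivity
  · simp [Fin.sum_univ_succ]; ring

theorem isEntropic_curveB {e q : ℝ} (h0 : 0 ≤ e) (hq : 0 ≤ q) (h : e + 3 * q = 1) :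
    IsEntropic (curveB e q) := by
  refine isEntropic_binaryEntropies _ (fun s => ?_) ?_
  · fin_cases s <;> simp [h0, hq]
  · simp [Fin.sum_univ_succ]; linarith

theorem isEntropic_curveC {a b c : ℝ} (ha : 0 ≤ a) (hb : 0 ≤ b) (hc : 0 ≤ c)
    (h : a + b + c = 1 / 2) : IsEntropic (curveC a b c) := by
  refine isEntropic_binaryEntropies _ (fun s => ?_) ?_
  · fin_cases s <;> simp [ha, hb, hc]
  · simp [Fin.sum_univ_succ]; linarith

theorem isBinaryEntropic_curveD {e : ℝ} (h0 : 0 ≤ e) (h : e ≤ 1 / 5) :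
    IsBinaryEntropic (epsCurve e) (curveD e) := by
  have h' : e ≤ 5⁻¹ := by linarith
  refine isBinaryEntropic_of_pmf (p := ![1 / 5 - e, 1 / 5, 1 / 5, 1 / 5, 1 / 5, e]) (fun s => ?_) ?_
    (fun v s => digit v ((![0b0010, 0b0110, 0b1010, 0b1101, 0b1111, 0b1100] : Fin 6 → ℕ) s))
    (epsCurve e) fun i j k l => ?_
  · fin_cases s <;> simp [h0, h']
  · simp [Fin.sum_univ_succ]; ring
  · fin_cases i <;> fin_cases j <;> fin_cases k <;> fin_cases l <;>
      simp [marg, Finset.sum_filter, Fin.sum_univ_succ, digit, epsCurve]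

theorem IsBinaryEntropic.isEntropic {p h} (hh : IsBinaryEntropic p h) : IsEntropic h := by
  obtain ⟨Ω, m, μ, hμ, ξ, hξ, -, rfl⟩ := hh
  exact ⟨Ω, m, μ, hμ, fun _ => 2, ξ, hξ, rfl⟩

theorem essentiallyConditional_double_zero : EssentiallyConditional (double 0) := by
  refine essentiallyConditional_pair (by decide) fun l m hl hm => ?_
  -- On this curve `Δ(X,Y) = 0`, so `l` plays no role, and `Δ(X,Y|Z) = 2e η(1-e) - η(1-e²) ≤ 2e²`.
  -- Ingleton equals `η(2e-2e²) - η(2e-e²) - η(1-e²)`, which the choice of `log e` and `log 2 < 1`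
  -- bound by `-(1+2m)e²`. The total is at most `-e²`.
  set e := exp (-(3 + 2 * m)) with he
  have e0 : 0 < e := exp_pos _
  have e1 : e < 1 := exp_lt_one_iff.2 (by linarith)
  have hloge : log e = -(3 + 2 * m) := log_exp _
  have hh := isEntropic_curveA e0.le e1.le
  refine ⟨_, hh, ?_⟩
  rw [delta_ci_eq _ {X} {Y} {X, Y}, delta_ci_eq _ {X, Z} {Y, Z} {X, Y, Z}, ingleton,
    hh.apply_empty]
  simp only [curveA_z, curveA_u, curveA_xy, curveA_xz, curveA_xu, curveA_yz, curveA_yu, curveA_zu,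
    curveA_xzu, curveA_yzu, curveA_x, curveA_y, curveA_xyz]
  rw [show (1 - e) ^ 2 + e * (1 - e) = 1 - e by ring, show e * (1 - e) + e ^ 2 = e by ring,
    show 1 - e + e * (1 - e) = 1 - e ^ 2 by ring,
    show e * (1 - e) + e * (1 - e) + e ^ 2 = 2 * e - e ^ 2 by ring,
    show e * (1 - e) + e * (1 - e) = 2 * e - 2 * e ^ 2 by ring]
  have hp1 : negMulLog ((1 - e) ^ 2) = 2 * (1 - e) * negMulLog (1 - e) := by
    rw [sq, negMulLog_mul]; ring
  have hp2 : negMulLog (e * (1 - e)) = (1 - e) * negMulLog e + e * negMulLog (1 - e) :=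
    negMulLog_mul _ _
  have hp3 : negMulLog (e ^ 2) = 2 * e * negMulLog e := by
    rw [sq, negMulLog_mul]; ring
  have t1 : negMulLog (1 - e) ≤ e := by
    have := negMulLog_sub_le (x := 1 - e) (y := 1) (by linarith) one_pos
    simp at this
    linarith
  have t2 : 0 ≤ negMulLog (1 - e ^ 2) := negMulLog_nonneg (by nlinarith) (by nlinarith)
  have t3 := negMulLog_sub_le (x := 2 * e - 2 * e ^ 2) (y := 2 * e - e ^ 2) (by nlinarith)
    (by nlinarith)
  have t4 : log (2 * e - e ^ 2) ≤ log 2 + log e := by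
    rw [← log_mul two_ne_zero e0.ne']
    exact log_le_log (by nlinarith) (by nlinarith)
  have t5 : log 2 < 1 := log_two_lt_d9.trans (by norm_num)
  have t6 : negMulLog (2 * e - 2 * e ^ 2) - negMulLog (2 * e - e ^ 2) ≤ -(e ^ 2 * (1 + 2 * m)) := by
    nlinarith [sq_nonneg e]
  rw [hp1, hp2, hp3]
  have t7 := mul_le_mul_of_nonneg_left t1 (mul_nonneg hm e0.le)
  have t8 := mul_nonneg hm t2
  have t9 := pow_pos e0 2
  nlinarith

theorem negMulLog_curveB {e q : ℝ} (h0 : 0 < e) (h1 : e ≤ 1 / 2) (h : e + 3 * q = 1) :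
    negMulLog (e + q) - negMulLog q ≤ 4 * e ∧ negMulLog (q + q) - negMulLog (e + q + q) ≤ e := by
  have hq0 : 0 < q := by linarith
  have hlq := one_sub_inv_le_log_of_pos hq0
  -- `e ≤ 1/2` gives `q ≥ 1/6`, so the slope `-log q - 1` of `η` at `q` is at most `6 - 2 = 4`.
  have hlq' : q⁻¹ ≤ 6 := by
    rw [inv_le_comm₀ hq0 (by norm_num)]; linarith
  have t1 := negMulLog_sub_le (x := e + q) (y := q) (by linarith) hq0
  have t2 := negMulLog_sub_le (x := q + q) (y := e + q + q) (by linarith) (by linarith)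
  have t3 : log (e + q + q) ≤ 0 := log_nonpos (by linarith) (by linarith)
  constructor <;> nlinarith

/-- The mass `e` is an atom of its own in two positive and three negative terms, leaving `-η(e) = e
log e`. The rest is `3(η(e+q) - η(q)) + 2(η(2q) - η(e+2q)) ≤ 12e + 2e`. -/
theorem ingleton_curveB_le {e q : ℝ} (h0 : 0 < e) (h1 : e ≤ 1 / 2) (h : e + 3 * q = 1) :
    ingleton (curveB e q) ≤ e * log e + 14 * e := by
  obtain ⟨t1, t2⟩ := negMulLog_curveB h0 h1 h
  rw [ingleton]
  simp only [curveB_z, curveB_u, curveB_xy, curveB_xz, curveB_xu, curveB_yz, curveB_yu, curveB_zu,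
    curveB_xzu, curveB_yzu]
  have t4 : negMulLog e = -(e * log e) := by rw [negMulLog]; ring
  linarith

theorem exp_neg_le_half {x : ℝ} (hx : 1 ≤ x) : exp (-x) ≤ 1 / 2 := by
  have := add_one_le_exp x
  rw [exp_neg, inv_le_comm₀ (exp_pos _) (by norm_num)]
  linarith

theorem essentiallyConditional_double_one : EssentiallyConditional (double 1) := by
  refine essentiallyConditional_pair (by decide) fun l m hl hm => ?_
  -- Both `Δ` terms equal `η(e+q) - η(q) + η(2q) - η(e+2q) ≤ 5e`; the 15 exceeds the 14 in
  -- `ingleton_curveB_le`.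
  obtain ⟨e, he⟩ : ∃ e, e = exp (-(15 + 5 * l + 5 * m)) := ⟨_, rfl⟩
  have e0 : 0 < e := he ▸ exp_pos _
  have e1 : e ≤ 1 / 2 := he ▸ exp_neg_le_half (by linarith)
  have hloge : log e = -(15 + 5 * l + 5 * m) := he ▸ log_exp _
  have hq : e + 3 * ((1 - e) / 3) = 1 := by ring
  refine ⟨_, isEntropic_curveB e0.le (by linarith) hq, ?_⟩
  have key := ingleton_curveB_le e0 e1 hq
  obtain ⟨t1, t2⟩ := negMulLog_curveB e0 e1 hq
  generalize (1 - e) / 3 = q at *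
  rw [delta_ci_eq _ {X, Z} {Y, Z} {X, Y, Z}, delta_ci_eq _ {Y, Z} {Z, U} {Y, Z, U}]
  simp only [curveB_z, curveB_xz, curveB_yz, curveB_zu, curveB_yzu, curveB_xyz]
  rw [hloge] at key
  nlinarith

theorem essentiallyConditional_double_three : EssentiallyConditional (double 3) := by
  refine essentiallyConditional_pair (by decide) fun l m hl hm => ?_
  -- The same curve serves: `Δ(X,Z|U) ≤ 5e`, and `Δ(Z,U|X) = 0` since each value of `X` fixes `Z` or
  -- `U`.
  obtain ⟨e, he⟩ : ∃ e, e = exp (-(15 + 5 * l + 5 * m)) := ⟨_, rfl⟩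
  have e0 : 0 < e := he ▸ exp_pos _
  have e1 : e ≤ 1 / 2 := he ▸ exp_neg_le_half (by linarith)
  have hloge : log e = -(15 + 5 * l + 5 * m) := he ▸ log_exp _
  have hq : e + 3 * ((1 - e) / 3) = 1 := by ring
  refine ⟨_, isEntropic_curveB e0.le (by linarith) hq, ?_⟩
  have key := ingleton_curveB_le e0 e1 hq
  obtain ⟨t1, t2⟩ := negMulLog_curveB e0 e1 hq
  generalize (1 - e) / 3 = q at *
  rw [delta_ci_eq _ {X, U} {Z, U} {X, Z, U}, delta_ci_eq _ {X, Z} {X, U} {X, Z, U}]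
  simp only [curveB_x, curveB_u, curveB_xz, curveB_xu, curveB_zu, curveB_xzu]
  rw [hloge] at key
  nlinarith

theorem half_negMulLog_sub_le {s : ℝ} (h0 : 0 ≤ s) (h1 : s ≤ 1) :
    negMulLog (1 + s) / 2 - negMulLog (1 + s / 2) ≤ -(s ^ 2 / 16) := by
  let F : ℝ → ℝ := fun s => negMulLog (1 + s) / 2 - negMulLog (1 + s / 2) + s ^ 2 / 16
  have hd : ∀ x, 0 ≤ x → HasDerivAt F ((-log (1 + x) - 1) / 2 - (-log (1 + x / 2) - 1) * (1 / 2)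
      + 2 * x / 16) x := fun x hx => by
    have a1 := (hasDerivAt_negMulLog (x := 1 + x) (by linarith)).comp x
      ((hasDerivAt_id x).const_add 1)
    have a2 := (hasDerivAt_negMulLog (x := 1 + x / 2) (by linarith)).comp x
      (((hasDerivAt_id x).div_const 2).const_add 1)
    have a3 := ((hasDerivAt_id x).pow 2).div_const 16
    exact (((a1.div_const 2).sub a2).add a3).congr_deriv (by simp)
  have hanti : AntitoneOn F (Set.Icc 0 1) := by
    refine antitoneOn_of_deriv_nonpos (convex_Icc 0 1)
      (fun x hx => (hd x hx.1).continuousAt.continuousWithinAt) (fun x hx => ?_) fun x hx => ?_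
    · exact (hd x (interior_subset hx).1).differentiableAt.differentiableWithinAt
    · obtain ⟨hx0, hx1⟩ := interior_subset hx
      rw [(hd x hx0).deriv]
      have := one_sub_inv_le_log_of_pos (x := (1 + x) / (1 + x / 2)) (by positivity)
      rw [log_div (by positivity) (by positivity), inv_div] at this
      -- Hence `log ((1+x)/(1+x/2)) ≥ x/4`, which exactly balances the derivative `x/8` of `s²/16`.
      -- It amounts to `x² ≤ x`, so it needs `x ≤ 1`.
      have h2 : (1 + x / 2) / (1 + x) ≤ 1 - x / 4 := by
        rw [div_le_iff₀ (by positivity)]; nlinarith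
      linarith
  have := hanti ⟨le_rfl, zero_le_one⟩ ⟨h0, h1⟩ h0
  simp only [F] at this
  norm_num at this
  linarith

/-- The derivative is `-2 - log (1-s²)`, with `-3s² ≤ log (1-s²) ≤ 0`; the difference from `-2s` is
therefore of third order. -/
theorem negMulLog_odd_bounds {s : ℝ} (h0 : 0 ≤ s) (h1 : s ≤ 1 / 2) :
    -(2 * s) ≤ negMulLog (1 + s) - negMulLog (1 - s) ∧
      negMulLog (1 + s) - negMulLog (1 - s) ≤ -(2 * s) + s ^ 3 := by
  have hd : ∀ x, 0 ≤ x → x ≤ 1 / 2 → HasDerivAt (fun s => negMulLog (1 + s) - negMulLog (1 - s))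
      (-(2 + log (1 - x ^ 2))) x := fun x hx hx1 => by
    have a1 := (hasDerivAt_negMulLog (x := 1 + x) (by linarith)).comp x
      ((hasDerivAt_id x).const_add 1)
    have a2 := (hasDerivAt_negMulLog (x := 1 - x) (by linarith)).comp x
      ((hasDerivAt_id x).const_sub 1)
    refine (a1.sub a2).congr_deriv ?_
    rw [show 1 - x ^ 2 = (1 + x) * (1 - x) by ring, log_mul (by linarith) (by linarith)]
    ring
  have hlog : ∀ x : ℝ, 0 ≤ x → x ≤ 1 / 2 → log (1 - x ^ 2) ≤ 0 ∧ -(3 * x ^ 2) ≤ log (1 - x ^ 2) :=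
    fun x hx hx1 => by
      have hpos : 0 < 1 - x ^ 2 := by nlinarith
      refine ⟨log_nonpos hpos.le (by nlinarith), ?_⟩
      have := one_sub_inv_le_log_of_pos hpos
      have h2 : (1 - x ^ 2)⁻¹ ≤ 1 + 3 * x ^ 2 := by
        have hx2 : x ^ 2 ≤ 1 / 4 := by nlinarith
        rw [inv_le_iff_one_le_mul₀ hpos]
        nlinarith [mul_nonneg (sq_nonneg x) (by linarith : 0 ≤ 2 - 3 * x ^ 2)]
      linarith
  have hd1 := fun x hx hx1 => (hd x hx hx1).add ((hasDerivAt_id x).const_mul 2)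
  have hd2 := fun x hx hx1 => (hd1 x hx hx1).sub ((hasDerivAt_id x).pow 3)
  constructor
  · have : MonotoneOn _ (Set.Icc (0 : ℝ) (1 / 2)) := monotoneOn_of_deriv_nonneg (convex_Icc _ _)
      (fun x hx => (hd1 x hx.1 hx.2).continuousAt.continuousWithinAt)
      (fun x hx => (hd1 x (interior_subset hx).1
        (interior_subset hx).2).differentiableAt.differentiableWithinAt) fun x hx => by
        obtain ⟨hx0, hx1⟩ := interior_subset hx
        rw [(hd1 x hx0 hx1).deriv]
        linarith [(hlog x hx0 hx1).1]
    have := this ⟨le_rfl, by norm_num⟩ ⟨h0, h1⟩ h0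
    simp at this
    linarith
  · have : AntitoneOn _ (Set.Icc (0 : ℝ) (1 / 2)) := antitoneOn_of_deriv_nonpos (convex_Icc _ _)
      (fun x hx => (hd2 x hx.1 hx.2).continuousAt.continuousWithinAt)
      (fun x hx => (hd2 x (interior_subset hx).1
        (interior_subset hx).2).differentiableAt.differentiableWithinAt) fun x hx => by
        obtain ⟨hx0, hx1⟩ := interior_subset hx
        rw [(hd2 x hx0 hx1).deriv]
        have := (hlog x hx0 hx1).2
        simp
        linarith
    have := this ⟨le_rfl, by norm_num⟩ ⟨h0, h1⟩ h0
    simp at this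
    linarith

theorem essentiallyConditional_double_two : EssentiallyConditional (double 2) := by
  refine essentiallyConditional_pair (by decide) fun l m hl hm => ?_
  -- There is no logarithmic singularity on this curve: Ingleton is `η(1+s)/2 - η(1+s/2) ≤ -s²/16`,
  -- while both `Δ` terms equal the same odd expression, at most `s³/4`. So `(l+m)s < 1/4` suffices.
  obtain ⟨s, hs⟩ : ∃ s : ℝ, s = 1 / (4 * (l + m) + 4) := ⟨_, rfl⟩
  have s0 : 0 < s := by rw [hs]; positivity
  have s1 : s ≤ 1 / 4 := by
    rw [hs]; exact one_div_le_one_div_of_le (by norm_num) (by linarith)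
  have hlm : (l + m) * s < 1 / 4 := by
    rw [hs, mul_one_div, div_lt_iff₀ (by positivity)]; linarith
  refine ⟨_, isEntropic_curveC (a := 1 / 4) (b := s / 4) (c := 1 / 4 - s / 4) (by norm_num)
    (by linarith) (by linarith) (by ring), ?_⟩
  rw [delta_ci_eq _ {X, U} {Z, U} {X, Z, U}, delta_ci_eq _ {X, Z} {Z, U} {X, Z, U}, ingleton]
  simp only [curveC_z, curveC_u, curveC_xy, curveC_xz, curveC_xu, curveC_yz, curveC_yu, curveC_zu,
    curveC_xzu, curveC_yzu]
  have n2 : negMulLog 2 = -(4 * negMulLog (1 / 2)) := by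
    have := negMulLog_mul 2 (1 / 2)
    norm_num at this ⊢
    linarith
  have n4 : negMulLog (1 / 4) = negMulLog (1 / 2) := by
    have := negMulLog_mul (1 / 2) (1 / 2)
    norm_num at this ⊢
    linarith
  have e1 : negMulLog (1 / 4 + s / 4) = 1 / 4 * negMulLog (1 + s) +
      (1 + s) * negMulLog (1 / 2) := by
    rw [show (1 : ℝ) / 4 + s / 4 = 1 / 4 * (1 + s) by ring, negMulLog_mul, n4]; ring
  have e2 : negMulLog (1 / 4 - s / 4) = 1 / 4 * negMulLog (1 - s) +
      (1 - s) * negMulLog (1 / 2) := by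
    rw [show (1 : ℝ) / 4 - s / 4 = 1 / 4 * (1 - s) by ring, negMulLog_mul, n4]; ring
  have e3 : negMulLog (1 / 4 + (1 / 4 - s / 4)) = 1 / 2 * negMulLog (1 - s / 2) +
      (1 - s / 2) * negMulLog (1 / 2) := by
    rw [show (1 : ℝ) / 4 + (1 / 4 - s / 4) = 1 / 2 * (1 - s / 2) by ring, negMulLog_mul]; ring
  have e4 : negMulLog (1 / 2 + s / 4) = 1 / 2 * negMulLog (1 + s / 2) +
      (1 + s / 2) * negMulLog (1 / 2) := by
    rw [show (1 : ℝ) / 2 + s / 4 = 1 / 2 * (1 + s / 2) by ring, negMulLog_mul]; ring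
  have e5 : negMulLog (s / 4 + s / 4) = 2 * negMulLog (s / 4) - s * negMulLog (1 / 2) := by
    rw [show s / 4 + s / 4 = 2 * (s / 4) by ring, negMulLog_mul, n2]; ring
  rw [show 1 / 4 - s / 4 + s / 4 = 1 / 4 by ring,
    show 1 / 4 + (1 / 4 - s / 4) + s / 4 = 1 / 2 by ring, e1, e2, e3, e4, e5, n4]
  have b1 := half_negMulLog_sub_le s0.le (by linarith)
  have b2 := (negMulLog_odd_bounds s0.le (by linarith)).2
  have b3 := (negMulLog_odd_bounds (s := s / 2) (by linarith) (by linarith)).1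
  have b4 : 1 / 4 * (negMulLog (1 + s) - negMulLog (1 - s)) -
      1 / 2 * (negMulLog (1 + s / 2) - negMulLog (1 - s / 2)) ≤ s ^ 3 / 4 := by linarith
  have b5 := mul_le_mul_of_nonneg_left b4 (add_nonneg hl hm)
  have b6 := mul_lt_mul_of_pos_right hlm (pow_pos s0 2)
  nlinarith

theorem exists_curveD_lt {l m : ℝ} (hl : 0 ≤ l) (hm : 0 ≤ m) : ∃ e₀ : ℝ, 0 < e₀ ∧ ∀ e, 0 < e →
    e < e₀ → e ≤ 1 / 5 ∧ ingleton (curveD e) + (l * delta (ci X Z {U}) (curveD e) +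
      m * delta (ci Y Z {U}) (curveD e)) < 0 := by
  -- Ingleton is `e log e` plus terms bounded by `26e`, and each `Δ` is at most `5e`; 30 and 6 leave
  -- slack.
  refine ⟨exp (-(30 + 6 * l + 6 * m)), exp_pos _, fun e e0 he => ?_⟩
  have e1 : e < 1 / 10 := by
    refine he.trans_le ?_
    have := add_one_le_exp (30 + 6 * l + 6 * m)
    rw [exp_neg, inv_le_comm₀ (exp_pos _) (by norm_num)]
    linarith
  refine ⟨by linarith, ?_⟩
  have hloge : log e < -(30 + 6 * l + 6 * m) := by
    rw [log_lt_iff_lt_exp e0]; exact he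
  rw [delta_ci_eq _ {X, U} {Z, U} {X, Z, U}, delta_ci_eq _ {Y, U} {Z, U} {Y, Z, U}, ingleton]
  simp only [curveD_z, curveD_u, curveD_xy, curveD_xz, curveD_xu, curveD_yz, curveD_yu, curveD_zu,
    curveD_xzu, curveD_yzu]
  rw [show 1 / 5 - e + 1 / 5 = 2 / 5 - e by ring, show (1 : ℝ) / 5 + 1 / 5 = 2 / 5 by norm_num]
  rw [show 2 / 5 - e + 1 / 5 = 3 / 5 - e by ring, show 3 / 5 - e + 1 / 5 = 4 / 5 - e by ring,
    show 3 / 5 - e + e = 3 / 5 by ring]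
  -- These two identities give `4η(2/5) = 4η(1/5) + η(4/5)`, that is, Ingleton vanishes at `e = 0`.
  have n2 : negMulLog (2 / 5) = 2 * negMulLog (1 / 5) + 1 / 5 * negMulLog 2 := by
    rw [show (2 : ℝ) / 5 = 1 / 5 * 2 by norm_num, negMulLog_mul]
  have n4 : negMulLog (4 / 5) = 4 * negMulLog (1 / 5) + 4 / 5 * negMulLog 2 := by
    rw [show (4 : ℝ) / 5 = 1 / 5 * 2 * 2 by norm_num, negMulLog_mul, negMulLog_mul]; ring
  have l1 := one_sub_inv_le_log_of_pos (x := 1 / 5) (by norm_num)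
  have l2 := one_sub_inv_le_log_of_pos (x := 2 / 5) (by norm_num)
  have l3 := one_sub_inv_le_log_of_pos (x := 3 / 5) (by norm_num)
  have l4 : log (4 / 5 - e) ≤ 0 := log_nonpos (by linarith) (by linarith)
  have l5 : log (2 / 5 + e) ≤ 0 := log_nonpos (by linarith) (by linarith)
  have l6 := one_sub_inv_le_log_of_pos (x := 1 / 5 - e) (by linarith)
  have l6' : (1 / 5 - e)⁻¹ ≤ 10 := by
    rw [inv_le_comm₀ (by linarith) (by norm_num)]; linarith
  have l7 : log (2 / 5) ≤ 0 := log_nonpos (by norm_num) (by norm_num)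
  have l8 : log (3 / 5) ≤ 0 := log_nonpos (by norm_num) (by norm_num)
  norm_num at l1 l2 l3
  have t1 : negMulLog (2 / 5 - e) - negMulLog (2 / 5) ≤ e := by
    nlinarith [negMulLog_sub_le (x := 2 / 5 - e) (y := 2 / 5) (by linarith) (by norm_num)]
  have t2 : negMulLog (1 / 5 + e) - negMulLog (1 / 5) ≤ 4 * e := by
    have := negMulLog_sub_le (x := 1 / 5 + e) (y := 1 / 5) (by linarith) (by norm_num)
    norm_num at this ⊢
    nlinarith
  have t3 : negMulLog (3 / 5 - e) - negMulLog (3 / 5) ≤ e := by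
    nlinarith [negMulLog_sub_le (x := 3 / 5 - e) (y := 3 / 5) (by linarith) (by norm_num)]
  have t4 : negMulLog (1 / 5) - negMulLog (1 / 5 - e) ≤ 9 * e := by
    nlinarith [negMulLog_sub_le (x := 1 / 5) (y := 1 / 5 - e) (by norm_num) (by linarith)]
  have t5 : negMulLog (2 / 5) - negMulLog (2 / 5 + e) ≤ e := by
    nlinarith [negMulLog_sub_le (x := 2 / 5) (y := 2 / 5 + e) (by norm_num) (by linarith)]
  have t6 : negMulLog (4 / 5) - negMulLog (4 / 5 - e) ≤ e := by
    have l9 := one_sub_inv_le_log_of_pos (x := 4 / 5 - e) (by linarith)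
    have l10 : (4 / 5 - e)⁻¹ ≤ 2 := by
      rw [inv_le_comm₀ (by linarith) (by norm_num)]; linarith
    nlinarith [negMulLog_sub_le (x := 4 / 5) (y := 4 / 5 - e) (by norm_num) (by linarith)]
  have te : negMulLog e = -(e * log e) := by rw [negMulLog]; ring
  have tl := mul_lt_mul_of_pos_left hloge e0
  have td : negMulLog (1 / 5 + e) - negMulLog (1 / 5) + (negMulLog (3 / 5 - e) -
      negMulLog (3 / 5)) ≤ 5 * e := by linarith
  have dl := mul_le_mul_of_nonneg_left td hl
  have dm := mul_le_mul_of_nonneg_left td hm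
  have el := mul_nonneg hl e0.le
  have em := mul_nonneg hm e0.le
  linarith

theorem essentiallyConditional_double_four : EssentiallyConditional (double 4) := by
  refine essentiallyConditional_pair (by decide) fun l m hl hm => ?_
  obtain ⟨e₀, he₀, H⟩ := exists_curveD_lt hl hm
  obtain ⟨h1, h2⟩ := H (e₀ / 2) (half_pos he₀) (half_lt_self he₀)
  exact ⟨_, (isBinaryEntropic_curveD (half_pos he₀).le h1).isEntropic, h2⟩

theorem essentiallyConditional_double (a : Fin 5) : EssentiallyConditional (double a) := by
  fin_cases a
  exacts [essentiallyConditional_double_zero, essentiallyConditional_double_one,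
    essentiallyConditional_double_two, essentiallyConditional_double_three,
    essentiallyConditional_double_four]

theorem exists_epsCurve_lt (lam : ElemCI → ℝ) (hlam : ∀ c ∈ double 4, 0 ≤ lam c) :
    ∃ ε₀ : ℝ, 0 < ε₀ ∧ ∀ ε : ℝ, 0 < ε → ε < ε₀ →
      ∃ h : Finset Var → ℝ, IsBinaryEntropic (epsCurve ε) h ∧
        ingleton h + ∑ c ∈ double 4, lam c * delta c h < 0 := by
  have hd : double 4 = {ci X Z {U}, ci Y Z {U}} := rfl
  obtain ⟨e₀, he₀, H⟩ := exists_curveD_lt (hlam (ci X Z {U}) (by simp [hd]))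
    (hlam (ci Y Z {U}) (by simp [hd]))
  refine ⟨e₀, he₀, fun e h0 h1 => ⟨_, isBinaryEntropic_curveD h0.le (H e h0 h1).1, ?_⟩⟩
  rw [hd, Finset.sum_pair (by decide)]
  exact (H e h0 h1).2

end CondIngleton

theorem mainTheorem1 :
    -- the inclusion-minimal sets of assumptions are exactly the symmetric images of the ten
    (∀ L : Finset ElemCI,
      Minimal ImpliesIngleton L ↔ ∃ k : Fin 5 ⊕ Fin 5, SameUpToSymmetry (ten k) L) ∧
    -- the ten are pairwise different up to symmetry
    (∀ k k' : Fin 5 ⊕ Fin 5, SameUpToSymmetry (ten k) (ten k') → k = k') ∧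
    -- essential conditionality
    (∀ a : Fin 5, ¬ EssentiallyConditional (single a)) ∧
    (∀ a : Fin 5, EssentiallyConditional (double a)) ∧
    -- the last set of two assumptions: each unconditional version is violated along the curve
    (∀ lam : ElemCI → ℝ, (∀ c ∈ double 4, 0 ≤ lam c) →
      ∃ ε₀ : ℝ, 0 < ε₀ ∧ ∀ ε : ℝ, 0 < ε → ε < ε₀ →
        ∃ h : Finset Var → ℝ, IsBinaryEntropic (epsCurve ε) h ∧
          ingleton h + ∑ c ∈ double 4, lam c * delta c h < 0) :=
  ⟨minimal_impliesIngleton_iff, fun _ _ => ten_inequivalent, not_essentiallyConditional_single,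
    essentiallyConditional_double, exists_epsCurve_lt⟩
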